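/- Let $M$ be a smooth manifold of dimension four (without boundary, Hausdorff and second countable; neither connectedness nor orientability is assumed). For a Riemannian metric $g$ on $M$ let $\nabla$ be its Levi-Civita connection, with the convention $[\nabla_a,\nabla_b]w^c=R_{ab}{}^c{}_d w^d$, Ricci tensor $R_{bc}=R_{ab}{}^a{}_c$ and scalar curvature $R=g^{ab}R_{ab}$. Let $P_{ab}=\frac12\left(R_{ab}-\frac{R}{6}g_{ab}\right)$ be the Schouten tensor and $J=g^{ab}P_{ab}$. For closed 1-forms $u,v$ on $M$ put $$Q_1^g v_a=-\nabla_a\nabla^b v_b-4P_a{}^b v_b+2Jv_a,\qquad Q_1^g(u,v)=u^a\,Q_1^g v_a,$$ with indices raised by $g$. The function $Q_1^g(u,v)$ is regarded as a conformal density of weight $-4$, where a function $f$ in the scale $g$ stands for the density $f\,\sigma_g^{-4}$; in dimension four this amounts to the density $f\,dg$, with $dg$ the Riemannian volume density. So, for $\hat g=e^{2\Upsilon}g$, a function $\hat f$ in the scale $\hat g$ and a function $f$ in the scale $g$ represent the same density if and only if $e^{4\Upsilon}\hat f=f$. Let $u,v$ be smooth closed 1-forms on $M$, let $\Upsilon\in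 C^\infty(M)$ and $\hat g=e^{2\Upsilon}g$. Then, as densities of weight $-4$, $$Q_1^{\hat g}(u,v)=Q_1^g(u,v)+4\nabla^a\left(u^b v_{[a}\nabla_{b]}\Upsilon\right),$$ where $\nabla$ and the raising of indices on the right are those of $g$ and $v_{[a}\nabla_{b]}\Upsilon=\frac12\left(v_a\nabla_b\Upsilon-v_b\nabla_a\Upsilon\right)$; that is, $e^{4\Upsilon}Q_1^{\hat g}(u,v)=Q_1^g(u,v)+4\nabla^a\left(u^b v_{[a}\nabla_{b]}\Upsilon\right)$ as functions, when the left-hand pairing is computed with $\hat g$. If moreover $M$ is closed (compact), then $Q_1^g(u,v)$ and $Q_1^{\hat g}(u,v)$ are integrable for the respective Riemannian measures, and the integral is conformally invariant: $$\int_M Q_1^{\hat g}(u,v)\,d\hat g=\int_M Q_1^g(u,v)\,dg.$$ -/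

import Mathlib

open Bundle FiberBundle VectorField MeasureTheory
open scoped Manifold ContDiff

noncomputable section
namespace ConfQ

/-- Smooth Riemannian metrics on a smooth `n`-manifold. -/
abbrev RiemMetric (n : ℕ) (M : Type*) [TopologicalSpace M]
    [ChartedSpace (EuclideanSpace ℝ (Fin n)) M] [IsManifold (𝓡 n) ∞ M] :=
  ContMDiffRiemannianMetric (𝓡 n) ∞ (EuclideanSpace ℝ (Fin n)) (TangentSpace (𝓡 n) : M → Type _)

variable {n : ℕ} {M : Type*} [TopologicalSpace M] [ChartedSpace (EuclideanSpace ℝ (Fin n)) M]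

instance tangentSpace_finiteDimensional (x : M) :
    FiniteDimensional ℝ (TangentSpace (𝓡 n) x) :=
  inferInstanceAs (FiniteDimensional ℝ (EuclideanSpace ℝ (Fin n)))

instance tangentSpace_t2Space (x : M) : T2Space (TangentSpace (𝓡 n) x) :=
  inferInstanceAs (T2Space (EuclideanSpace ℝ (Fin n)))

variable [IsManifold (𝓡 n) ∞ M]

/-- The vector field `X` is differentiable at `x`. -/
abbrev FieldDiffAt (X : Π y : M, TangentSpace (𝓡 n) y) (x : M) : Prop :=
  MDifferentiableAt (𝓡 n) ((𝓡 n).prod 𝓘(ℝ, EuclideanSpace ℝ (Fin n)))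
    (fun y ↦ (⟨y, X y⟩ : TangentBundle (𝓡 n) M)) x

theorem inner_injective (g : RiemMetric n M) (x : M) :
    Function.Injective (g.inner x : TangentSpace (𝓡 n) x →ₗ[ℝ] TangentSpace (𝓡 n) x →L[ℝ] ℝ) := by
  rw [injective_iff_map_eq_zero]
  intro v hv
  by_contra hne
  have h := g.pos x v hne
  have h2 : g.inner x v v = 0 := by
    have := congrArg (fun φ : TangentSpace (𝓡 n) x →L[ℝ] ℝ => φ v) hv
    simpa using this
  linarith

/-- Lowering an index: `v^a ↦ g_{ab} v^b`. -/
def flat (g : RiemMetric n M) (x : M) :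
    TangentSpace (𝓡 n) x ≃ₗ[ℝ] (TangentSpace (𝓡 n) x →L[ℝ] ℝ) :=
  haveI : FiniteDimensional ℝ (TangentSpace (𝓡 n) x →L[ℝ] ℝ) :=
    LinearMap.toContinuousLinearMap.finiteDimensional
  LinearMap.linearEquivOfInjective (g.inner x : TangentSpace (𝓡 n) x →ₗ[ℝ] _)
    (inner_injective g x)
    ((Subspace.dual_finrank_eq (K := ℝ) (V := TangentSpace (𝓡 n) x)).symm.trans
      (LinearMap.toContinuousLinearMap (𝕜 := ℝ) (E := TangentSpace (𝓡 n) x) (F' := ℝ)).finrank_eq)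

/-- Raising an index: `u_a ↦ u^a = g^{ab} u_b`. -/
def sharp (g : RiemMetric n M) (x : M) (θ : TangentSpace (𝓡 n) x →L[ℝ] ℝ) : TangentSpace (𝓡 n) x :=
  (flat g x).symm θ

theorem inner_sharp (g : RiemMetric n M) (x : M) (θ : TangentSpace (𝓡 n) x →L[ℝ] ℝ)
    (v : TangentSpace (𝓡 n) x) : g.inner x (sharp g x θ) v = θ v := by
  change (flat g x (sharp g x θ)) v = θ v
  simp [sharp]

theorem mdifferentiableAt_inner (g : RiemMetric n M) {x : M} {X Y : Π y : M, TangentSpace (𝓡 n) y}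
    (hX : FieldDiffAt X x) (hY : FieldDiffAt Y x) :
    MDifferentiableAt (𝓡 n) 𝓘(ℝ, ℝ) (fun y ↦ g.inner y (X y) (Y y)) x := by
  have : MDifferentiableAt (𝓡 n) ((𝓡 n).prod 𝓘(ℝ)) (fun m ↦ TotalSpace.mk' ℝ
      (E := Bundle.Trivial M ℝ) m (g.inner m (X m) (Y m))) x := by
    apply MDifferentiableAt.clm_bundle_apply₂ (F₁ := EuclideanSpace ℝ (Fin n))
      (F₂ := EuclideanSpace ℝ (Fin n))
    · exact (g.contMDiff x).mdifferentiableAt (by simp)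
    · exact hX
    · exact hY
  simp only [mdifferentiableAt_totalSpace] at this
  exact this.2

/-- The right-hand side of the Koszul formula for `g(∇_X Y, Z)`. -/
def koszul (g : RiemMetric n M) (X Y Z : Π y : M, TangentSpace (𝓡 n) y) (x : M) : ℝ :=
  2⁻¹ * (mvfderiv (𝓡 n) (fun y ↦ g.inner y (Y y) (Z y)) x (X x)
    + mvfderiv (𝓡 n) (fun y ↦ g.inner y (X y) (Z y)) x (Y x)
    - mvfderiv (𝓡 n) (fun y ↦ g.inner y (X y) (Y y)) x (Z x)
    + g.inner x (mlieBracket (𝓡 n) X Y x) (Z x) - g.inner x (mlieBracket (𝓡 n) X Z x) (Y x)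
    - g.inner x (mlieBracket (𝓡 n) Y Z x) (X x))

section
variable (g : RiemMetric n M) {x : M} {X Y Z : Π y : M, TangentSpace (𝓡 n) y}

theorem inner_add_left' (X Y Z : Π y : M, TangentSpace (𝓡 n) y) :
    (fun y ↦ g.inner y ((X + Y) y) (Z y)) =
      (fun y ↦ g.inner y (X y) (Z y)) + (fun y ↦ g.inner y (Y y) (Z y)) := by
  ext y; simp

theorem inner_add_right' (X Y Z : Π y : M, TangentSpace (𝓡 n) y) :
    (fun y ↦ g.inner y (Z y) ((X + Y) y)) =
      (fun y ↦ g.inner y (Z y) (X y)) + (fun y ↦ g.inner y (Z y) (Y y)) := by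
  ext y; simp

theorem inner_smul_left' (f : M → ℝ) (X Z : Π y : M, TangentSpace (𝓡 n) y) :
    (fun y ↦ g.inner y ((f • X) y) (Z y)) = f * (fun y ↦ g.inner y (X y) (Z y)) := by
  ext y; simp

theorem inner_smul_right' (f : M → ℝ) (X Z : Π y : M, TangentSpace (𝓡 n) y) :
    (fun y ↦ g.inner y (Z y) ((f • X) y)) = f * (fun y ↦ g.inner y (Z y) (X y)) := by
  ext y; simp

theorem koszul_tensorial_left (hY : FieldDiffAt Y x) (hZ : FieldDiffAt Z x) :
    TensorialAt (𝓡 n) (EuclideanSpace ℝ (Fin n)) (fun X ↦ koszul g X Y Z x) x where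
  smul {f X} hf hX := by
    have h1 := mdifferentiableAt_inner g hX hZ
    have h2 := mdifferentiableAt_inner g hX hY
    simp only [koszul, inner_smul_left', mvfderiv_mul hf h1, mvfderiv_mul hf h2,
      mlieBracket_smul_left hf hX]
    simp
    ring
  add {X X'} hX hX' := by
    have h1 := mdifferentiableAt_inner g hX hZ
    have h2 := mdifferentiableAt_inner g hX hY
    have h1' := mdifferentiableAt_inner g hX' hZ
    have h2' := mdifferentiableAt_inner g hX' hY
    simp only [koszul, inner_add_left', mvfderiv_add h1 h1', mvfderiv_add h2 h2',
      mlieBracket_add_left hX hX']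
    simp
    ring

theorem koszul_tensorial_right (hX : FieldDiffAt X x) (hY : FieldDiffAt Y x) :
    TensorialAt (𝓡 n) (EuclideanSpace ℝ (Fin n)) (fun Z ↦ koszul g X Y Z x) x where
  smul {f Z} hf hZ := by
    have h1 := mdifferentiableAt_inner g hX hZ
    have h2 := mdifferentiableAt_inner g hY hZ
    simp only [koszul, inner_smul_right', mvfderiv_mul hf h1, mvfderiv_mul hf h2,
      mlieBracket_smul_right hf hZ]
    simp [g.symm x (Z x)]
    ring
  add {Z Z'} hZ hZ' := by
    have h1 := mdifferentiableAt_inner g hX hZ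
    have h2 := mdifferentiableAt_inner g hY hZ
    have h1' := mdifferentiableAt_inner g hX hZ'
    have h2' := mdifferentiableAt_inner g hY hZ'
    simp only [koszul, inner_add_right', mvfderiv_add h1 h1', mvfderiv_add h2 h2',
      mlieBracket_add_right hZ hZ']
    simp
    ring

theorem koszul_add_middle {Y' : Π y : M, TangentSpace (𝓡 n) y} (hX : FieldDiffAt X x)
    (hY : FieldDiffAt Y x) (hY' : FieldDiffAt Y' x) (hZ : FieldDiffAt Z x) :
    koszul g X (Y + Y') Z x = koszul g X Y Z x + koszul g X Y' Z x := by
  simp only [koszul, inner_add_right', inner_add_left',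
    mvfderiv_add (mdifferentiableAt_inner g hX hY) (mdifferentiableAt_inner g hX hY'),
    mvfderiv_add (mdifferentiableAt_inner g hY hZ) (mdifferentiableAt_inner g hY' hZ),
    mlieBracket_add_right hY hY', mlieBracket_add_left hY hY']
  simp
  ring

theorem koszul_smul_middle {f : M → ℝ} (hf : MDifferentiableAt (𝓡 n) 𝓘(ℝ, ℝ) f x) (hX : FieldDiffAt X x)
    (hY : FieldDiffAt Y x) (hZ : FieldDiffAt Z x) :
    koszul g X (f • Y) Z x = f x * koszul g X Y Z x + mvfderiv (𝓡 n) f x (X x) * g.inner x (Y x) (Z x) := by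
  simp only [koszul, inner_smul_right', inner_smul_left',
    mvfderiv_mul hf (mdifferentiableAt_inner g hX hY),
    mvfderiv_mul hf (mdifferentiableAt_inner g hY hZ),
    mlieBracket_smul_right hf hY, mlieBracket_smul_left hf hY]
  simp [g.symm x (Y x) (X x)]
  ring

open Classical in
/-- `∇_v Y` at `x`, determined by the Koszul formula (and `0` if `Y` is not differentiable at `x`).
As in Mathlib, the arguments are ordered so that `leviCivitaFun g Y x v` is `∇_v Y`. -/
def leviCivitaFun (Y : Π y : M, TangentSpace (𝓡 n) y) (x : M) :
    TangentSpace (𝓡 n) x →L[ℝ] TangentSpace (𝓡 n) x :=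
  if hY : FieldDiffAt Y x then
    LinearMap.toContinuousLinearMap ((flat g x).symm.toLinearMap ∘ₗ
      (TensorialAt.mkHom₂ (fun X Z ↦ koszul g X Y Z x) x
        (fun _ hZ ↦ koszul_tensorial_left g hY hZ)
        (fun _ hX ↦ koszul_tensorial_right g hX hY)).toLinearMap)
  else 0

theorem inner_leviCivitaFun (hX : FieldDiffAt X x) (hY : FieldDiffAt Y x)
    (hZ : FieldDiffAt Z x) :
    g.inner x (leviCivitaFun g Y x (X x)) (Z x) = koszul g X Y Z x := by
  have h : leviCivitaFun g Y x (X x) = sharp g x ((TensorialAt.mkHom₂ (fun X Z ↦ koszul g X Y Z x) x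
        (fun _ hZ ↦ koszul_tensorial_left g hY hZ)
        (fun _ hX ↦ koszul_tensorial_right g hX hY)) (X x)) := by
    simp only [leviCivitaFun, dif_pos hY]
    rfl
  rw [h, inner_sharp]
  exact TensorialAt.mkHom₂_apply _ _ hX hZ

theorem eq_of_inner_eq {v w : TangentSpace (𝓡 n) x}
    (h : ∀ z, g.inner x v z = g.inner x w z) : v = w :=
  inner_injective g x (ContinuousLinearMap.ext h)

/-- The Levi-Civita connection of `g`; `leviCivita g Y x v` is `∇_v Y`. It is torsion free and
compatible with `g`, see `leviCivita_torsion` and `leviCivita_metric`. -/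
def leviCivita : CovariantDerivative (𝓡 n) (EuclideanSpace ℝ (Fin n))
    (TangentSpace (𝓡 n) : M → Type _) where
  toFun := leviCivitaFun g
  isCovariantDerivativeOnUniv :=
    { add := fun {Y Y' x} hY hY' _ ↦ by
        ext1 v
        refine eq_of_inner_eq g fun z ↦ ?_
        have hv := mdifferentiableAt_extend (𝓡 n) (EuclideanSpace ℝ (Fin n)) v
        have hz := mdifferentiableAt_extend (𝓡 n) (EuclideanSpace ℝ (Fin n)) z
        have e1 := inner_leviCivitaFun g hv hY hz
        have e2 := inner_leviCivitaFun g hv hY' hz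
        have e3 := inner_leviCivitaFun g hv (mdifferentiableAt_add_section hY hY') hz
        have e4 := koszul_add_middle g hv hY hY' hz
        simp only [extend_apply_self] at e1 e2 e3
        simp only [add_apply, map_add, e1, e2]
        exact e3.trans e4
      leibniz := fun {Y f x} hY hf _ ↦ by
        ext1 v
        refine eq_of_inner_eq g fun z ↦ ?_
        have hv := mdifferentiableAt_extend (𝓡 n) (EuclideanSpace ℝ (Fin n)) v
        have hz := mdifferentiableAt_extend (𝓡 n) (EuclideanSpace ℝ (Fin n)) z
        have e1 := inner_leviCivitaFun g hv hY hz
        have e3 := inner_leviCivitaFun g hv (hf.smul_section hY) hz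
        have e4 := koszul_smul_middle g hf hv hY hz
        simp only [extend_apply_self] at e1 e3 e4
        simp only [add_apply, map_add, smul_apply,
          ContinuousLinearMap.smulRight_apply, map_smul, smul_eq_mul, e1]
        exact e3.trans e4 }

theorem leviCivita_torsion : (leviCivita g).torsion = 0 := by
  rw [CovariantDerivative.torsion_eq_zero_iff]
  intro X Y x hX hY
  refine eq_of_inner_eq g fun z ↦ ?_
  have hz := mdifferentiableAt_extend (𝓡 n) (EuclideanSpace ℝ (Fin n)) z
  have e1 := inner_leviCivitaFun g hX hY hz
  have e2 := inner_leviCivitaFun g hY hX hz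
  simp only [extend_apply_self] at e1 e2
  change g.inner x (leviCivitaFun g Y x (X x) - leviCivitaFun g X x (Y x)) z = _
  rw [map_sub, sub_apply, e1, e2]
  simp only [koszul, extend_apply_self, mlieBracket_swap_apply (V := Y) (W := X)]
  have : (fun y ↦ g.inner y (X y) (Y y)) = (fun y ↦ g.inner y (Y y) (X y)) := by
    ext y; exact g.symm y _ _
  rw [this]
  simp
  ring

theorem leviCivita_metric (hX : FieldDiffAt X x) (hY : FieldDiffAt Y x)
    (hZ : FieldDiffAt Z x) :
    mvfderiv (𝓡 n) (fun y ↦ g.inner y (Y y) (Z y)) x (X x) =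
      g.inner x (leviCivita g Y x (X x)) (Z x) + g.inner x (Y x) (leviCivita g Z x (X x)) := by
  have e1 := inner_leviCivitaFun g hX hY hZ
  have e2 := inner_leviCivitaFun g hX hZ hY
  change _ = g.inner x (leviCivitaFun g Y x (X x)) (Z x) +
    g.inner x (Y x) (leviCivitaFun g Z x (X x))
  rw [g.symm x (Y x), e1, e2]
  simp only [koszul, mlieBracket_swap_apply (V := Z) (W := Y)]
  have : (fun y ↦ g.inner y (Z y) (Y y)) = (fun y ↦ g.inner y (Y y) (Z y)) := by
    ext y; exact g.symm y _ _
  rw [this]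
  simp
  ring
end


set_option synthInstance.maxHeartbeats 200000 in
/-- The conformally rescaled metric `e^{2Υ} g`. -/
def rescale (g : RiemMetric n M) (Υ : M → ℝ) (hΥ : ContMDiff (𝓡 n) 𝓘(ℝ, ℝ) ∞ Υ) : RiemMetric n M where
  inner x := Real.exp (2 * Υ x) • g.inner x
  symm x v w := by simp [g.symm x v w]
  pos x v hv := by
    simpa using mul_pos (Real.exp_pos _) (g.pos x v hv)
  isVonNBounded x := by
    have h := (g.isVonNBounded x).image (Real.exp (-Υ x) •
      ContinuousLinearMap.id ℝ (TangentSpace (𝓡 n) x))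
    refine h.subset fun v hv ↦ (Set.mem_image _ _ _).2 ⟨Real.exp (Υ x) • v, ?_, ?_⟩
    · have e : Real.exp (2 * Υ x) = Real.exp (Υ x) * Real.exp (Υ x) := by
        rw [← Real.exp_add]; ring_nf
      simp only [Set.mem_ofPred_eq] at hv ⊢
      simpa [e, mul_assoc] using hv
    · simp [smul_smul, ← Real.exp_add]
  contMDiff := by
    have h1 : ContMDiff (𝓡 n) 𝓘(ℝ, ℝ) ∞ (fun x ↦ Real.exp (2 * Υ x)) :=
      (Real.contDiff_exp.comp (contDiff_const.mul contDiff_id)).contMDiff.comp hΥ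
    exact h1.smul_section g.contMDiff

/-! ### Curvature -/

/-- A basis `e_i` of the tangent space at `x` (the coordinate basis of the preferred chart at `x`). -/
def stdVec (x : M) (i : Fin n) : TangentSpace (𝓡 n) x :=
  (EuclideanSpace.single i (1 : ℝ) : EuclideanSpace ℝ (Fin n))

/-- The dual basis `e^i`. -/
def stdCovec (x : M) (i : Fin n) : TangentSpace (𝓡 n) x →L[ℝ] ℝ :=
  (EuclideanSpace.proj i : EuclideanSpace ℝ (Fin n) →L[ℝ] ℝ)

/-- The metric trace `g^{ab} T_{ab} = ∑ i, T(e_i, (e^i)^♯)` of a bilinear form `T`. -/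
def metricTrace (g : RiemMetric n M) (x : M)
    (T : TangentSpace (𝓡 n) x → TangentSpace (𝓡 n) x → ℝ) : ℝ :=
  ∑ i, T (stdVec x i) (sharp g x (stdCovec x i))

/-- `R(X, Y) Z = ∇_X ∇_Y Z - ∇_Y ∇_X Z - ∇_{[X, Y]} Z` for vector fields. -/
def curvatureField (g : RiemMetric n M) (X Y Z : Π y : M, TangentSpace (𝓡 n) y) (x : M) :
    TangentSpace (𝓡 n) x :=
  leviCivita g (fun y ↦ leviCivita g Z y (Y y)) x (X x)
    - leviCivita g (fun y ↦ leviCivita g Z y (X y)) x (Y x)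
    - leviCivita g Z x (mlieBracket (𝓡 n) X Y x)

/-- The curvature `X^a Y^b R_{ab}^c_d Z^d` on tangent vectors at `x`, computed with local extensions
to smooth vector fields. -/
def riemann (g : RiemMetric n M) (x : M) (X Y Z : TangentSpace (𝓡 n) x) : TangentSpace (𝓡 n) x :=
  curvatureField g (extend (EuclideanSpace ℝ (Fin n)) X) (extend (EuclideanSpace ℝ (Fin n)) Y)
    (extend (EuclideanSpace ℝ (Fin n)) Z) x

/-- The Ricci tensor `R_{bc} = R_{ab}^a_c`. -/
def ricci (g : RiemMetric n M) (x : M) (Y Z : TangentSpace (𝓡 n) x) : ℝ :=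
  ∑ i, stdCovec x i (riemann g x (stdVec x i) Y Z)

def scalarCurvature (g : RiemMetric n M) (x : M) : ℝ := metricTrace g x (ricci g x)

/-- The Schouten tensor `P_{ab} = (R_{ab} - R / (2 (n - 1)) g_{ab}) / (n - 2)`. -/
def schouten (g : RiemMetric n M) (x : M) (Y Z : TangentSpace (𝓡 n) x) : ℝ :=
  1 / ((n : ℝ) - 2) *
    (ricci g x Y Z - scalarCurvature g x / (2 * ((n : ℝ) - 1)) * g.inner x Y Z)

/-- `J = g^{ab} P_{ab}`. -/
def schoutenTrace (g : RiemMetric n M) (x : M) : ℝ := metricTrace g x (schouten g x)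

/-- Fields of covectors; smoothness is the predicate `IsSmoothForm`. -/
abbrev Form (n : ℕ) (M : Type*) [TopologicalSpace M] [ChartedSpace (EuclideanSpace ℝ (Fin n)) M] :=
  Π x : M, TangentSpace (𝓡 n) x →L[ℝ] ℝ

def IsSmoothForm (u : Form n M) : Prop :=
  ContMDiff (𝓡 n) ((𝓡 n).prod 𝓘(ℝ, EuclideanSpace ℝ (Fin n) →L[ℝ] ℝ)) ∞
    (fun x ↦ TotalSpace.mk' (EuclideanSpace ℝ (Fin n) →L[ℝ] ℝ)
      (E := fun x : M ↦ TangentSpace (𝓡 n) x →L[ℝ] Bundle.Trivial M ℝ x) x (u x))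

/-- `du = 0`, where `du(X, Y) = X(u(Y)) - Y(u(X)) - u([X, Y])`. -/
def IsClosedForm (u : Form n M) : Prop :=
  ∀ (X Y : Π y : M, TangentSpace (𝓡 n) y) (x : M), FieldDiffAt X x → FieldDiffAt Y x →
    mvfderiv (𝓡 n) (fun y ↦ u y (Y y)) x (X x) - mvfderiv (𝓡 n) (fun y ↦ u y (X y)) x (Y x)
      - u x (mlieBracket (𝓡 n) X Y x) = 0

/-- The covariant derivative `X^a Y^b ∇_a u_b` of a 1-form. -/
def covForm (g : RiemMetric n M) (u : Form n M) (x : M) (X Y : TangentSpace (𝓡 n) x) : ℝ :=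
  mvfderiv (𝓡 n) (fun y ↦ u y (extend (EuclideanSpace ℝ (Fin n)) Y y)) x X
    - u x (leviCivita g (extend (EuclideanSpace ℝ (Fin n)) Y) x X)

/-- `∇^a u_a`. -/
def divergence (g : RiemMetric n M) (u : Form n M) (x : M) : ℝ := metricTrace g x (covForm g u x)

/-- `Y^a Q_1 v_a`, where `Q_1 v_a = -∇_a ∇^b v_b - 4 P_a^b v_b + 2 J v_a`. -/
def Q1 {M : Type*} [TopologicalSpace M] [ChartedSpace (EuclideanSpace ℝ (Fin 4)) M]
    [IsManifold (𝓡 4) ∞ M] (g : RiemMetric 4 M) (v : Form 4 M) (x : M) (Y : TangentSpace (𝓡 4) x) : ℝ :=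
  -mvfderiv (𝓡 4) (divergence g v) x Y - 4 * schouten g x Y (sharp g x (v x))
    + 2 * schoutenTrace g x * v x Y

/-- The pairing `Q_1(u, v) = u^a Q_1 v_a`, indices raised with `g`: the function which represents the
density `Q1Density` in the scale `g`. -/
def Q1Pair {M : Type*} [TopologicalSpace M] [ChartedSpace (EuclideanSpace ℝ (Fin 4)) M]
    [IsManifold (𝓡 4) ∞ M] (g : RiemMetric 4 M) (u v : Form 4 M) (x : M) : ℝ :=
  Q1 g v x (sharp g x (u x))

/-- The 1-form `u^b v_{[a} ∇_{b]} Υ = (u^b (∇_b Υ) v_a - u^b v_b ∇_a Υ) / 2`. -/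
def skewContraction (g : RiemMetric n M) (u v : Form n M) (Υ : M → ℝ) : Form n M := fun x ↦
  (2⁻¹ : ℝ) • (mvfderiv (𝓡 n) Υ x (sharp g x (u x)) • v x
    - v x (sharp g x (u x)) • mvfderiv (𝓡 n) Υ x)

/-! ### Conformal densities -/

/-- The fibre at `x` of the bundle `E[w] = ((Λ^n TM)^{⊗2})^{w / 2n}` of conformal densities of
weight `w`: an element is given by its components with respect to the frames of the tangent space
at `x`, which transform by the power `-w / n` of the absolute value of the determinant. Densities of
weight `-n` are the densities that can be integrated over an `n`-manifold. -/
def ConformalDensity (w : ℝ) (x : M) :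
    Submodule ℝ (Module.Basis (Fin n) ℝ (TangentSpace (𝓡 n) x) → ℝ) where
  carrier := {φ | ∀ b b', φ b' = |b.det b'| ^ (-w / n) * φ b}
  zero_mem' := by simp
  add_mem' {φ ψ} hφ hψ b b' := by simp only [Pi.add_apply, hφ b b', hψ b b']; ring
  smul_mem' c φ hφ b b' := by simp only [Pi.smul_apply, smul_eq_mul, hφ b b']; ring

/-- The matrix `g(e_i, e_j)`. -/
def gram (g : RiemMetric n M) (x : M) (e : Fin n → TangentSpace (𝓡 n) x) :
    Matrix (Fin n) (Fin n) ℝ :=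
  Matrix.of fun i j ↦ g.inner x (e i) (e j)

theorem gram_eq (g : RiemMetric n M) (x : M) (b b' : Module.Basis (Fin n) ℝ (TangentSpace (𝓡 n) x)) :
    gram g x b' = (b.toMatrix b').transpose * gram g x b * b.toMatrix b' := by
  ext i j
  conv_lhs => rw [gram, Matrix.of_apply, ← b.sum_toMatrix_smul_self b' i,
    ← b.sum_toMatrix_smul_self b' j]
  simp only [map_sum, map_smul, sum_apply, smul_apply, smul_eq_mul, Matrix.mul_apply,
    Matrix.transpose_apply, gram, Matrix.of_apply, Finset.mul_sum, Finset.sum_mul]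
  refine Finset.sum_congr rfl fun k _ ↦ Finset.sum_congr rfl fun l _ ↦ ?_
  ring

theorem gram_det_nonneg (g : RiemMetric n M) (x : M)
    (b : Module.Basis (Fin n) ℝ (TangentSpace (𝓡 n) x)) : 0 ≤ (gram g x b).det := by
  refine Matrix.PosSemidef.det_nonneg (Matrix.PosSemidef.of_dotProduct_mulVec_nonneg ?_ ?_)
  · ext i j
    simp [gram, g.symm x (b j)]
  · intro c
    have h : star c ⬝ᵥ (gram g x b).mulVec c = g.inner x (∑ i, c i • b i) (∑ i, c i • b i) := by
      simp only [gram, dotProduct, Matrix.mulVec, Matrix.of_apply, Finset.mul_sum, map_sum,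
        map_smul, sum_apply, smul_apply, smul_eq_mul, Pi.star_apply, star_trivial]
      refine Finset.sum_comm.trans (Finset.sum_congr rfl fun k _ ↦
        Finset.sum_congr rfl fun l _ ↦ ?_)
      ring
    rw [h]
    rcases eq_or_ne (∑ i, c i • b i) 0 with h0 | h0
    · simp [h0]
    · exact (g.pos x _ h0).le

/-- The density of weight `w` which the function `f` represents in the scale `g`, that is
`f σ^w` with `σ` the positive section of `E[1]` determined by `g` (the one with component `1` in
`g`-orthonormal frames). -/
def inScale (g : RiemMetric n M) (w : ℝ) (f : M → ℝ) (x : M) :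
    ConformalDensity (n := n) (M := M) w x :=
  ⟨fun b ↦ (gram g x b).det ^ (-w / (2 * n)) * f x, fun b b' ↦ by
    beta_reduce
    rw [gram_eq g x b b', Matrix.det_mul, Matrix.det_mul, Matrix.det_transpose,
      mul_right_comm, ← sq, Real.mul_rpow (sq_nonneg _) (gram_det_nonneg g x b),
      Module.Basis.det_apply, ← sq_abs, ← Real.rpow_natCast, ← Real.rpow_mul (abs_nonneg _),
      mul_assoc]
    congr 2
    push_cast
    by_cases hn : (n : ℝ) = 0
    · simp [hn]
    · field_simp⟩

/-- `Q_1^g(u, v)` as a section of `E[-4]`. -/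
def Q1Density {M : Type*} [TopologicalSpace M] [ChartedSpace (EuclideanSpace ℝ (Fin 4)) M]
    [IsManifold (𝓡 4) ∞ M] (g : RiemMetric 4 M) (u v : Form 4 M) (x : M) :
    ConformalDensity (n := 4) (M := M) (-4) x :=
  inScale g (-4) (Q1Pair g u v) x

/-- The coordinate vector fields `∂_i` of the chart at `x`, at the point with coordinates `y`. -/
def coordVec (x : M) (y : EuclideanSpace ℝ (Fin n)) (i : Fin n) :
    TangentSpace (𝓡 n) ((extChartAt (𝓡 n) x).symm y) :=
  mfderiv 𝓘(ℝ, EuclideanSpace ℝ (Fin n)) (𝓡 n) (extChartAt (𝓡 n) x).symm y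
    (EuclideanSpace.single i (1 : ℝ) : EuclideanSpace ℝ (Fin n))

/-- The measure `√(det g_{ij}) dy^1 ⋯ dy^n` on the domain of the chart at `x`, extended by `0`. -/
def chartVolume [MeasurableSpace M] (g : RiemMetric n M) (x : M) : Measure M :=
  (((volume : Measure (EuclideanSpace ℝ (Fin n))).restrict (extChartAt (𝓡 n) x).target).withDensity
    fun y ↦ ENNReal.ofReal (Real.sqrt
      (gram g ((extChartAt (𝓡 n) x).symm y) (coordVec x y)).det)).map (extChartAt (𝓡 n) x).symm

/-- The Riemannian measure `dg`, which restricts to `chartVolume g x` on the domain of the chart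
at `x`: the least measure that dominates all of these. -/
def riemannianVolume [MeasurableSpace M] (g : RiemMetric n M) : Measure M := ⨆ x : M, chartVolume g x

end ConfQ
end

/-! Write `U`, `V` for the fields `u^♯`, `v^♯` and `G` for the gradient of `Υ`. In dimension four
the pairing is `-U(div v) - 2 Ric(U, V) + (2/3) R ⟨U, V⟩` (`Q1Pair_eq`). The Koszul formula shows
how the connection changes under rescaling (`leviCivita_rescale`). From this follow the changes of
the curvature, of its traces and of the divergence (`curvatureField_rescale`, `ricci_rescale`,
`scalarCurvature_rescale`, `divergence_rescale`). After substitution the terms quadratic in `dΥ`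
cancel: `⟨G, U⟩⟨G, V⟩` between the derivative of the divergence and Ricci, `|G|² ⟨U, V⟩` between
Ricci and the scalar curvature. What remains is `2 (⟨∇_V G, U⟩ - ⟨∇_G V, U⟩ + ⟨G, U⟩ div v - ⟨U, V⟩
div G)`. The product rule gives the same expression for `4 ∇^a (u^b v_{[a} ∇_{b]} Υ)`. Closedness
enters as symmetry of the covariant derivative (`leviCivita_sharp_symm`): for `u` it removes the
terms in `∇u`, for `v` it matches the terms in `∇v`.

For the integrals, the factor `e^{4Υ}` is the ratio of the two volume densities, so the integrands
differ by a divergence, and the divergence theorem finishes. The measure being a supremum of chart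
measures, these are first shown to agree on overlaps, by change of variables; the supremum then
restricts to each of them (`riemannianVolume_restrict`). In a chart, `√(det g) div X` is a sum of
partial derivatives, by Jacobi's formula (`coordDensity_mul_fieldDiv`), and a partition of unity
reduces to fields supported in one chart. Integrability is continuity on a compact space with a
locally finite measure.

Index raising, the connection and the curvature are defined point by point, so their smoothness
needs proof. The main tool is `smoothFieldAt_of_inner`: it suffices to test against a coordinate
frame. -/

set_option linter.unusedSectionVars false

noncomputable section
namespace ConfQ

section

variable {n : ℕ} {M : Type*} [TopologicalSpace M] [ChartedSpace (EuclideanSpace ℝ (Fin n)) M]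
  [IsManifold (𝓡 n) ∞ M]

/-! ### Smooth functions and vector fields -/

/-- The function `f` is smooth at `x`. -/
abbrev SmoothFnAt (n : ℕ) {M : Type*} [TopologicalSpace M]
    [ChartedSpace (EuclideanSpace ℝ (Fin n)) M] (f : M → ℝ) (x : M) : Prop :=
  ContMDiffAt (𝓡 n) 𝓘(ℝ, ℝ) ∞ f x

/-- The vector field `X` is smooth at `x`. -/
abbrev SmoothFieldAt (X : Π y : M, TangentSpace (𝓡 n) y) (x : M) : Prop :=
  ContMDiffAt (𝓡 n) ((𝓡 n).prod 𝓘(ℝ, EuclideanSpace ℝ (Fin n))) ∞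
    (fun y ↦ (⟨y, X y⟩ : TangentBundle (𝓡 n) M)) x

theorem SmoothFieldAt.fieldDiffAt {X : Π y : M, TangentSpace (𝓡 n) y} {x : M}
    (h : SmoothFieldAt X x) : FieldDiffAt X x :=
  ContMDiffAt.mdifferentiableAt h (by simp)

theorem SmoothFieldAt.eventually_fieldDiffAt {X : Π y : M, TangentSpace (𝓡 n) y} {x : M}
    (h : SmoothFieldAt X x) : ∀ᶠ y in nhds x, FieldDiffAt X y := by
  have h1 := (contMDiffAt_iff_contMDiffAt_nhds (n := 1) (by simp)).1
    (ContMDiffAt.of_le h (by simp))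
  exact h1.mono fun y hy ↦ hy.mdifferentiableAt (by simp)

theorem SmoothFnAt.mdifferentiableAt {f : M → ℝ} {x : M} (h : SmoothFnAt n f x) :
    MDifferentiableAt (𝓡 n) 𝓘(ℝ, ℝ) f x :=
  ContMDiffAt.mdifferentiableAt h (by simp)

theorem smoothFieldAt_extend {x : M} (v : TangentSpace (𝓡 n) x) :
    SmoothFieldAt (extend (EuclideanSpace ℝ (Fin n)) v) x :=
  contMDiffAt_extend (𝓡 n) (EuclideanSpace ℝ (Fin n)) v

theorem SmoothFieldAt.add {X Y : Π y : M, TangentSpace (𝓡 n) y} {x : M}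
    (hX : SmoothFieldAt X x) (hY : SmoothFieldAt Y x) : SmoothFieldAt (X + Y) x :=
  ContMDiffAt.add_section hX hY

theorem SmoothFieldAt.sub {X Y : Π y : M, TangentSpace (𝓡 n) y} {x : M}
    (hX : SmoothFieldAt X x) (hY : SmoothFieldAt Y x) : SmoothFieldAt (X - Y) x :=
  ContMDiffAt.sub_section hX hY

theorem SmoothFieldAt.smul {f : M → ℝ} {X : Π y : M, TangentSpace (𝓡 n) y} {x : M}
    (hf : SmoothFnAt n f x) (hX : SmoothFieldAt X x) : SmoothFieldAt (f • X) x :=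
  ContMDiffAt.smul_section hf hX

theorem smoothFnAt_inner (g : RiemMetric n M) {x : M} {X Y : Π y : M, TangentSpace (𝓡 n) y}
    (hX : SmoothFieldAt X x) (hY : SmoothFieldAt Y x) :
    SmoothFnAt n (fun y ↦ g.inner y (X y) (Y y)) x := by
  have : ContMDiffAt (𝓡 n) ((𝓡 n).prod 𝓘(ℝ)) ∞ (fun m ↦ TotalSpace.mk' ℝ
      (E := Bundle.Trivial M ℝ) m (g.inner m (X m) (Y m))) x := by
    apply ContMDiffAt.clm_bundle_apply₂ (F₁ := EuclideanSpace ℝ (Fin n))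
      (F₂ := EuclideanSpace ℝ (Fin n))
    · exact g.contMDiff x
    · exact hX
    · exact hY
  simp only [contMDiffAt_totalSpace] at this
  exact this.2

theorem smoothFnAt_form {u : Form n M} (hu : IsSmoothForm u) {x : M}
    {X : Π y : M, TangentSpace (𝓡 n) y} (hX : SmoothFieldAt X x) :
    SmoothFnAt n (fun y ↦ u y (X y)) x := by
  have : ContMDiffAt (𝓡 n) ((𝓡 n).prod 𝓘(ℝ)) ∞ (fun m ↦ TotalSpace.mk' ℝ
      (E := Bundle.Trivial M ℝ) m (u m (X m))) x := by
    apply ContMDiffAt.clm_bundle_apply (F₁ := EuclideanSpace ℝ (Fin n))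
    · exact hu x
    · exact hX
  simp only [contMDiffAt_totalSpace] at this
  exact this.2

theorem smoothFnAt_mvfderiv {f : M → ℝ} {X : Π y : M, TangentSpace (𝓡 n) y} {x : M}
    (hf : SmoothFnAt n f x) (hX : SmoothFieldAt X x) :
    SmoothFnAt n (fun y ↦ mvfderiv (𝓡 n) f y (X y)) x := by
  have h1 := ContMDiffAt.mfderiv_const (m := ∞) hf (by simp)
  have h2 := ContMDiffAt.clm_apply_of_inCoordinates (b₂ := f) h1 hX hf
  -- `h2` makes the image of `X` a smooth map into the tangent bundle of `ℝ`; its fibre coordinate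
  -- is the derivative sought.
  exact (contMDiff_snd_tangentBundle_modelSpace (𝕜 := ℝ) (H := ℝ) (E := ℝ) (I := 𝓘(ℝ, ℝ))
    (n := ∞) _).comp x h2

theorem smoothFieldAt_mlieBracket {X Y : Π y : M, TangentSpace (𝓡 n) y} {x : M}
    (hX : SmoothFieldAt X x) (hY : SmoothFieldAt Y x) :
    SmoothFieldAt (mlieBracket (𝓡 n) X Y) x :=
  haveI : IsManifold (𝓡 n) (minSmoothness ℝ 2) M :=
    .of_le (n := ∞) (by simpa using WithTop.coe_le_coe.2 (le_top (a := (2 : ℕ∞))))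
  haveI : IsManifold (𝓡 n) ((⊤ : ℕ∞) + 1) M := .of_le (n := ∞) (by simp)
  ContMDiffAt.mlieBracket_vectorField (m := ⊤) (n := ⊤) hX hY (by simp)

/-! ### Coordinate frames -/

/-- The coordinate vector fields of the chart at `x₀`, as vector fields on `M` which vanish outside
the domain of the chart. -/
def coordFrame (x₀ : M) (i : Fin n) : Π y : M, TangentSpace (𝓡 n) y :=
  (trivializationAt (EuclideanSpace ℝ (Fin n)) (TangentSpace (𝓡 n)) x₀).localFrame
    (EuclideanSpace.basisFun (Fin n) ℝ).toBasis i

/-- The basis of the tangent space at `y` given by the coordinate vector fields of the chart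
at `x₀`. -/
def coordBasis (x₀ : M) {y : M} (hy : y ∈ (chartAt (EuclideanSpace ℝ (Fin n)) x₀).source) :
    Module.Basis (Fin n) ℝ (TangentSpace (𝓡 n) y) :=
  (trivializationAt (EuclideanSpace ℝ (Fin n)) (TangentSpace (𝓡 n)) x₀).basisAt
    (EuclideanSpace.basisFun (Fin n) ℝ).toBasis hy

theorem coordFrame_eq (x₀ : M) {y : M} (hy : y ∈ (chartAt (EuclideanSpace ℝ (Fin n)) x₀).source)
    (i : Fin n) : coordFrame x₀ i y = coordBasis x₀ hy i :=
  Bundle.Trivialization.localFrame_apply_of_mem_baseSet _ _ hy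

theorem smoothFieldAt_coordFrame (x₀ : M) {y : M}
    (hy : y ∈ (chartAt (EuclideanSpace ℝ (Fin n)) x₀).source) (i : Fin n) :
    SmoothFieldAt (coordFrame x₀ i) y :=
  contMDiffAt_localFrame_of_mem ∞ _ _ i hy

/-- The component functions of a vector field in the chart at `x₀`. -/
def coordCoeff (x₀ : M) (X : Π y : M, TangentSpace (𝓡 n) y) (i : Fin n) (y : M) : ℝ :=
  (trivializationAt (EuclideanSpace ℝ (Fin n)) (TangentSpace (𝓡 n)) x₀).localFrameCoeff (𝓡 n)
    (EuclideanSpace.basisFun (Fin n) ℝ).toBasis i y (X y)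

theorem coordCoeff_eq (x₀ : M) (X : Π y : M, TangentSpace (𝓡 n) y) (i : Fin n) {y : M}
    (hy : y ∈ (chartAt (EuclideanSpace ℝ (Fin n)) x₀).source) :
    coordCoeff x₀ X i y = (coordBasis x₀ hy).repr (X y) i :=
  Bundle.Trivialization.localFrameCoeff_apply_of_mem_baseSet _ _ hy X i

theorem smoothFieldAt_iff_coordCoeff (x₀ : M) (X : Π y : M, TangentSpace (𝓡 n) y) {y : M}
    (hy : y ∈ (chartAt (EuclideanSpace ℝ (Fin n)) x₀).source) :
    SmoothFieldAt X y ↔ ∀ i, SmoothFnAt n (coordCoeff x₀ X i) y :=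
  contMDiffAt_iff_localFrameCoeff _ hy

theorem eq_sum_coordCoeff (x₀ : M) (X : Π y : M, TangentSpace (𝓡 n) y) {y : M}
    (hy : y ∈ (chartAt (EuclideanSpace ℝ (Fin n)) x₀).source) :
    X y = ∑ i, coordCoeff x₀ X i y • coordFrame x₀ i y :=
  Bundle.Trivialization.eq_sum_localFrameCoeff_smul hy

theorem eventually_mem_chart_source {n : ℕ} {M : Type*} [TopologicalSpace M]
    [ChartedSpace (EuclideanSpace ℝ (Fin n)) M] {x₀ y : M}
    (hy : y ∈ (chartAt (EuclideanSpace ℝ (Fin n)) x₀).source) :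
    ∀ᶠ z in nhds y, z ∈ (chartAt (EuclideanSpace ℝ (Fin n)) x₀).source :=
  (chartAt (EuclideanSpace ℝ (Fin n)) x₀).open_source.mem_nhds hy

/-- The matrix of the metric in the chart at `x₀`. -/
def coordGram (g : RiemMetric n M) (x₀ y : M) : Matrix (Fin n) (Fin n) ℝ :=
  gram g y (fun i ↦ coordFrame x₀ i y)

theorem contMDiffAt_coordGram (g : RiemMetric n M) {x₀ y : M}
    (hy : y ∈ (chartAt (EuclideanSpace ℝ (Fin n)) x₀).source) (i j : Fin n) :
    SmoothFnAt n (fun z ↦ coordGram g x₀ z i j) y :=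
  smoothFnAt_inner g (smoothFieldAt_coordFrame x₀ hy i) (smoothFieldAt_coordFrame x₀ hy j)

theorem SmoothFnAt.sum {ι : Type*} {s : Finset ι} {f : ι → M → ℝ} {x : M}
    (h : ∀ i ∈ s, SmoothFnAt n (f i) x) : SmoothFnAt n (fun y ↦ ∑ i ∈ s, f i y) x :=
  contMDiffAt_finsetSum h

theorem SmoothFnAt.prod {ι : Type*} {s : Finset ι} {f : ι → M → ℝ} {x : M}
    (h : ∀ i ∈ s, SmoothFnAt n (f i) x) : SmoothFnAt n (fun y ↦ ∏ i ∈ s, f i y) x :=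
  contMDiffAt_finsetProd h

theorem SmoothFnAt.det {A : M → Matrix (Fin n) (Fin n) ℝ} {x : M}
    (h : ∀ i j, SmoothFnAt n (fun y ↦ A y i j) x) : SmoothFnAt n (fun y ↦ (A y).det) x := by
  simp only [Matrix.det_apply']
  exact SmoothFnAt.sum fun σ _ ↦ contMDiffAt_const.mul (SmoothFnAt.prod fun i _ ↦ h _ _)

/-- A vector in the kernel of the Gram matrix would be the coordinate vector of a nonzero tangent
vector orthogonal to the whole basis, hence to itself. -/
theorem gram_det_pos (g : RiemMetric n M) (x : M)
    (b : Module.Basis (Fin n) ℝ (TangentSpace (𝓡 n) x)) : 0 < (gram g x b).det := by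
  refine lt_of_le_of_ne (gram_det_nonneg g x b) fun h ↦ ?_
  obtain ⟨c, hc, hc'⟩ := Matrix.exists_mulVec_eq_zero_iff.2 h.symm
  have h0 : ∑ i, c i • b i ≠ 0 := fun h0 ↦
    hc (funext fun i ↦ Fintype.linearIndependent_iff.1 b.linearIndependent c h0 i)
  refine (g.pos x _ h0).ne' ?_
  have h1 : ∀ i, g.inner x (b i) (∑ j, c j • b j) = 0 := fun i ↦ by
    have := congrFun hc' i
    simp only [Matrix.mulVec, dotProduct, gram, Matrix.of_apply, Pi.zero_apply] at this
    simp only [map_sum, map_smul, smul_eq_mul]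
    rw [← this]
    exact Finset.sum_congr rfl fun j _ ↦ mul_comm _ _
  conv_lhs => rw [g.symm]
  rw [map_sum]
  refine Finset.sum_eq_zero fun i _ ↦ ?_
  rw [map_smul, g.symm, h1, smul_zero]

theorem coordGram_eq (g : RiemMetric n M) {x₀ y : M}
    (hy : y ∈ (chartAt (EuclideanSpace ℝ (Fin n)) x₀).source) :
    coordGram g x₀ y = gram g y (coordBasis x₀ hy) := by
  have : (fun i ↦ coordFrame x₀ i y) = coordBasis x₀ hy := funext fun i ↦ coordFrame_eq x₀ hy i
  rw [coordGram, this]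

theorem coordGram_det_pos (g : RiemMetric n M) {x₀ y : M}
    (hy : y ∈ (chartAt (EuclideanSpace ℝ (Fin n)) x₀).source) : 0 < (coordGram g x₀ y).det := by
  rw [coordGram_eq g hy]
  exact gram_det_pos g y _

/-- A vector field is smooth at `y` if its inner products with the coordinate vector fields are. -/
theorem smoothFieldAt_of_inner (g : RiemMetric n M) {x₀ y : M}
    (hy : y ∈ (chartAt (EuclideanSpace ℝ (Fin n)) x₀).source) {X : Π y : M, TangentSpace (𝓡 n) y}
    (h : ∀ i, SmoothFnAt n (fun z ↦ g.inner z (coordFrame x₀ i z) (X z)) y) : SmoothFieldAt X y := by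
  rw [smoothFieldAt_iff_coordCoeff x₀ X hy]
  intro i
  -- Cramer's rule: the components of `X` solve a linear system whose matrix is the Gram matrix and
  -- whose right-hand side is the given inner products. Each component is thus a quotient of
  -- determinants with smooth entries.
  have key : ∀ᶠ z in nhds y, coordCoeff x₀ X i z = (coordGram g x₀ z).det⁻¹ *
      ((coordGram g x₀ z).updateCol i
        (fun j ↦ g.inner z (coordFrame x₀ j z) (X z))).det := by
    filter_upwards [eventually_mem_chart_source hy] with z hz
    have h1 : (fun j ↦ g.inner z (coordFrame x₀ j z) (X z)) =
        (coordGram g x₀ z).mulVec (fun k ↦ coordCoeff x₀ X k z) := by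
      ext j
      conv_lhs => rw [eq_sum_coordCoeff x₀ X hz]
      simp only [map_sum, map_smul, Matrix.mulVec, dotProduct, coordGram, gram, Matrix.of_apply,
        smul_eq_mul]
      exact Finset.sum_congr rfl fun _ _ ↦ mul_comm _ _
    rw [h1, ← Matrix.cramer_apply, Matrix.cramer_eq_adjugate_mulVec, Matrix.mulVec_mulVec,
      Matrix.adjugate_mul, Matrix.smul_mulVec, Matrix.one_mulVec, Pi.smul_apply, smul_eq_mul,
      inv_mul_cancel_left₀ (coordGram_det_pos g hz).ne']
  refine ContMDiffAt.congr_of_eventuallyEq ?_ key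
  refine ContMDiffAt.mul ?_ ?_
  · exact ContMDiffAt.inv₀ (SmoothFnAt.det fun i j ↦ contMDiffAt_coordGram g hy i j)
      (coordGram_det_pos g hy).ne'
  · refine SmoothFnAt.det fun j k ↦ ?_
    simp only [Matrix.updateCol_apply]
    by_cases hk : k = i
    · simpa [hk] using h j
    · simpa [hk] using contMDiffAt_coordGram g hy j k

theorem smoothFieldAt_sharp (g : RiemMetric n M) {u : Form n M} (hu : IsSmoothForm u) (x : M) :
    SmoothFieldAt (fun y ↦ sharp g y (u y)) x := by
  refine smoothFieldAt_of_inner g (mem_chart_source _ x) fun i ↦ ?_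
  have : (fun z ↦ g.inner z (coordFrame x i z) (sharp g z (u z))) =
      fun z ↦ u z (coordFrame x i z) := by
    ext z; rw [g.symm, inner_sharp]
  rw [this]
  exact smoothFnAt_form hu (smoothFieldAt_coordFrame x (mem_chart_source _ x) i)

theorem smoothFieldAt_grad (g : RiemMetric n M) {f : M → ℝ} {x : M} (hf : SmoothFnAt n f x) :
    SmoothFieldAt (fun y ↦ sharp g y (mvfderiv (𝓡 n) f y)) x := by
  refine smoothFieldAt_of_inner g (mem_chart_source _ x) fun i ↦ ?_
  have : (fun z ↦ g.inner z (coordFrame x i z) (sharp g z (mvfderiv (𝓡 n) f z))) =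
      fun z ↦ mvfderiv (𝓡 n) f z (coordFrame x i z) := by
    ext z; rw [g.symm, inner_sharp]
  rw [this]
  exact smoothFnAt_mvfderiv hf (smoothFieldAt_coordFrame x (mem_chart_source _ x) i)

/-! ### Smoothness of covariant derivatives. -/

theorem inner_leviCivita (g : RiemMetric n M) {x : M} {X Y Z : Π y : M, TangentSpace (𝓡 n) y}
    (hX : FieldDiffAt X x) (hY : FieldDiffAt Y x) (hZ : FieldDiffAt Z x) :
    g.inner x (leviCivita g Y x (X x)) (Z x) = koszul g X Y Z x :=
  inner_leviCivitaFun g hX hY hZ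

theorem smoothFnAt_koszul (g : RiemMetric n M) {x : M} {X Y Z : Π y : M, TangentSpace (𝓡 n) y}
    (hX : SmoothFieldAt X x) (hY : SmoothFieldAt Y x) (hZ : SmoothFieldAt Z x) :
    SmoothFnAt n (koszul g X Y Z) x := by
  have h1 := smoothFnAt_mvfderiv (smoothFnAt_inner g hY hZ) hX
  have h2 := smoothFnAt_mvfderiv (smoothFnAt_inner g hX hZ) hY
  have h3 := smoothFnAt_mvfderiv (smoothFnAt_inner g hX hY) hZ
  have h4 := smoothFnAt_inner g (smoothFieldAt_mlieBracket hX hY) hZ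
  have h5 := smoothFnAt_inner g (smoothFieldAt_mlieBracket hX hZ) hY
  have h6 := smoothFnAt_inner g (smoothFieldAt_mlieBracket hY hZ) hX
  exact contMDiffAt_const.mul (((((h1.add h2).sub h3).add h4).sub h5).sub h6)

/-- The covariant derivative of a smooth vector field along a smooth vector field is smooth. -/
theorem smoothFieldAt_leviCivita (g : RiemMetric n M) {x : M}
    {X Y : Π y : M, TangentSpace (𝓡 n) y} (hX : SmoothFieldAt X x) (hY : SmoothFieldAt Y x) :
    SmoothFieldAt (fun y ↦ leviCivita g Y y (X y)) x := by
  refine smoothFieldAt_of_inner g (mem_chart_source _ x) fun i ↦ ?_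
  have hZ := smoothFieldAt_coordFrame x (mem_chart_source _ x) i
  -- The Koszul identity is available only where the three fields are differentiable, which holds
  -- near `x` because they are smooth at `x`.
  refine ContMDiffAt.congr_of_eventuallyEq (smoothFnAt_koszul g hX hY hZ) ?_
  filter_upwards [hX.eventually_fieldDiffAt, hY.eventually_fieldDiffAt,
    hZ.eventually_fieldDiffAt] with y h1 h2 h3
  rw [g.symm]
  exact inner_leviCivita g h1 h2 h3

end

/-! ### Coordinate vector fields as partial derivatives. -/

section

variable {n : ℕ} {M : Type*} [TopologicalSpace M] [ChartedSpace (EuclideanSpace ℝ (Fin n)) M]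
  [IsManifold (𝓡 n) ∞ M]

theorem coordFrame_eq_symmL (x₀ : M) {y : M}
    (hy : y ∈ (chartAt (EuclideanSpace ℝ (Fin n)) x₀).source) (i : Fin n) :
    coordFrame x₀ i y =
      (trivializationAt (EuclideanSpace ℝ (Fin n)) (TangentSpace (𝓡 n)) x₀).symmL ℝ y
        (EuclideanSpace.single i (1 : ℝ)) := by
  rw [coordFrame_eq x₀ hy]
  change ((EuclideanSpace.basisFun (Fin n) ℝ).toBasis.map (Bundle.Trivialization.linearEquivAt ℝ
    (trivializationAt (EuclideanSpace ℝ (Fin n)) (TangentSpace (𝓡 n)) x₀) y hy).symm) i = _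
  rw [Module.Basis.map_apply, OrthonormalBasis.coe_toBasis, EuclideanSpace.basisFun_apply,
    Bundle.Trivialization.symmL_apply]
  · rfl
  · exact hy

theorem coordFrame_eq_mfderiv (x₀ : M) {y : M}
    (hy : y ∈ (chartAt (EuclideanSpace ℝ (Fin n)) x₀).source) (i : Fin n) :
    coordFrame x₀ i y =
      mfderiv 𝓘(ℝ, EuclideanSpace ℝ (Fin n)) (𝓡 n) (extChartAt (𝓡 n) x₀).symm
        (extChartAt (𝓡 n) x₀ y) (EuclideanSpace.single i (1 : ℝ) : EuclideanSpace ℝ (Fin n)) := by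
  rw [coordFrame_eq_symmL x₀ hy, TangentBundle.symmL_trivializationAt hy]
  simp only [modelWithCornersSelf_coe, Set.range_id, mfderivWithin_univ]
  rfl

theorem mfderiv_extChartAt_coordFrame (x₀ : M) {y : M}
    (hy : y ∈ (chartAt (EuclideanSpace ℝ (Fin n)) x₀).source) (i : Fin n) :
    mfderiv (𝓡 n) 𝓘(ℝ, EuclideanSpace ℝ (Fin n)) (extChartAt (𝓡 n) x₀) y (coordFrame x₀ i y) =
      (EuclideanSpace.single i (1 : ℝ) : EuclideanSpace ℝ (Fin n)) := by
  rw [coordFrame_eq_mfderiv x₀ hy]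
  have h := mfderiv_extChartAt_comp_mfderivWithin_extChartAt_symm' (I := 𝓡 n) (x := x₀) (y := y)
    (by simpa using hy)
  simp only [modelWithCornersSelf_coe, Set.range_id, mfderivWithin_univ] at h
  exact congrArg (fun A ↦ A (EuclideanSpace.single i (1 : ℝ) : EuclideanSpace ℝ (Fin n))) h

theorem mvfderiv_coordFrame {x₀ y : M}
    (hy : y ∈ (chartAt (EuclideanSpace ℝ (Fin n)) x₀).source) {f : M → ℝ}
    (hf : MDifferentiableAt (𝓡 n) 𝓘(ℝ, ℝ) f y) (i : Fin n) :
    mvfderiv (𝓡 n) f y (coordFrame x₀ i y) =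
      fderiv ℝ (f ∘ (extChartAt (𝓡 n) x₀).symm) (extChartAt (𝓡 n) x₀ y)
        (EuclideanSpace.single i (1 : ℝ)) := by
  have hy' : y ∈ (extChartAt (𝓡 n) x₀).source := by simpa using hy
  have h1 : MDifferentiableAt 𝓘(ℝ, EuclideanSpace ℝ (Fin n)) (𝓡 n) (extChartAt (𝓡 n) x₀).symm
      (extChartAt (𝓡 n) x₀ y) := by
    have := mdifferentiableWithinAt_extChartAt_symm (I := 𝓡 n)
      ((extChartAt (𝓡 n) x₀).map_source hy')
    simpa only [modelWithCornersSelf_coe, Set.range_id, mdifferentiableWithinAt_univ] using this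
  have h2 := mfderiv_comp_of_eq (x := extChartAt (𝓡 n) x₀ y) hf h1
    ((extChartAt (𝓡 n) x₀).left_inv hy')
  rw [← mfderiv_eq_fderiv, h2, coordFrame_eq_mfderiv x₀ hy]
  -- The chain rule produces the differential at `(extChartAt (𝓡 n) x₀).symm (extChartAt (𝓡 n) x₀
  -- y)`, which equals `y` only propositionally. As every tangent space unfolds to the model space,
  -- the comparison can be stated for a free point `z`.
  have e : ∀ z, z = y → ∀ w : EuclideanSpace ℝ (Fin n),
      mvfderiv (𝓡 n) f y w = mfderiv (𝓡 n) 𝓘(ℝ, ℝ) f z w := by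
    rintro _ rfl w
    rfl
  exact e _ ((extChartAt (𝓡 n) x₀).left_inv hy') _

/-- Near `y` the coordinate fields are pullbacks under the chart of constant fields on Euclidean
space. Those commute, and pullback preserves brackets. -/
theorem mlieBracket_coordFrame {x₀ y : M}
    (hy : y ∈ (chartAt (EuclideanSpace ℝ (Fin n)) x₀).source) (i j : Fin n) :
    mlieBracket (𝓡 n) (coordFrame x₀ i) (coordFrame x₀ j) y = 0 := by
  let V : Fin n → Π z : EuclideanSpace ℝ (Fin n), TangentSpace 𝓘(ℝ, EuclideanSpace ℝ (Fin n)) z :=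
    fun i _ ↦ (EuclideanSpace.single i (1 : ℝ) : EuclideanSpace ℝ (Fin n))
  have hV : ∀ i z, MDifferentiableAt 𝓘(ℝ, EuclideanSpace ℝ (Fin n))
      (𝓘(ℝ, EuclideanSpace ℝ (Fin n)).tangent)
      (fun w ↦ (⟨w, V i w⟩ : TangentBundle 𝓘(ℝ, EuclideanSpace ℝ (Fin n)) _)) z := fun i z ↦
    ((contMDiffAt_vectorSpace_iff_contDiffAt (n := 1)).2 contDiffAt_const).mdifferentiableAt
      (by simp)
  have hφ : ∀ z ∈ (chartAt (EuclideanSpace ℝ (Fin n)) x₀).source, ∀ i,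
      mpullback (𝓡 n) 𝓘(ℝ, EuclideanSpace ℝ (Fin n)) (extChartAt (𝓡 n) x₀) (V i) z =
        coordFrame x₀ i z := by
    intro z hz i
    rw [mpullback_apply]
    have hinv := isInvertible_mfderiv_extChartAt (I := 𝓡 n) (x := x₀) (y := z) (by simpa using hz)
    rw [show V i (extChartAt (𝓡 n) x₀ z) = _ from (mfderiv_extChartAt_coordFrame x₀ hz i).symm]
    exact hinv.inverse_apply_self _
  have : IsManifold (𝓡 n) (minSmoothness ℝ 3) M :=
    .of_le (n := ∞) (by simpa using WithTop.coe_le_coe.2 (le_top (a := (3 : ℕ∞))))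
  have h := mpullback_mlieBracket (I := 𝓡 n) (n := ∞) (hV i (extChartAt (𝓡 n) x₀ y)) (hV j _)
    (contMDiffAt_extChartAt' hy)
    (by simpa using WithTop.coe_le_coe.2 (le_top (a := (2 : ℕ∞))))
  have h0 : mlieBracket 𝓘(ℝ, EuclideanSpace ℝ (Fin n)) (V i) (V j) = 0 := by
    ext1 z
    rw [← mlieBracketWithin_univ, mlieBracketWithin_eq_lieBracketWithin]
    simp only [lieBracketWithin, V, fderivWithin_fun_const]
    simp
    rfl
  rw [h0] at h
  have e : ∀ i, mpullback (𝓡 n) 𝓘(ℝ, EuclideanSpace ℝ (Fin n)) (extChartAt (𝓡 n) x₀) (V i)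
      =ᶠ[nhds y] coordFrame x₀ i := fun i ↦ by
    filter_upwards [eventually_mem_chart_source hy] with z hz using hφ z hz i
  rw [(e i).mlieBracket_vectorField_eq (e j)] at h
  rw [← h]
  simp [mpullback_apply]

theorem contDiffAt_comp_extChartAt_symm {x₀ y : M}
    (hy : y ∈ (chartAt (EuclideanSpace ℝ (Fin n)) x₀).source) {f : M → ℝ} (hf : SmoothFnAt n f y) :
    ContDiffAt ℝ ∞ (f ∘ (extChartAt (𝓡 n) x₀).symm) (extChartAt (𝓡 n) x₀ y) := by
  have hy' : y ∈ (extChartAt (𝓡 n) x₀).source := by simpa using hy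
  rw [← contMDiffAt_iff_contDiffAt]
  refine ContMDiffAt.comp_of_eq hf ?_ ((extChartAt (𝓡 n) x₀).left_inv hy')
  exact (contMDiffOn_extChartAt_symm x₀).contMDiffAt
    ((isOpen_extChartAt_target x₀).mem_nhds ((extChartAt (𝓡 n) x₀).map_source hy'))

theorem SmoothFnAt.eventually_mdifferentiableAt {f : M → ℝ} {x : M} (h : SmoothFnAt n f x) :
    ∀ᶠ y in nhds x, MDifferentiableAt (𝓡 n) 𝓘(ℝ, ℝ) f y := by
  have h1 := (contMDiffAt_iff_contMDiffAt_nhds (n := 1) (by simp)).1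
    (ContMDiffAt.of_le h (by simp))
  exact h1.mono fun y hy ↦ hy.mdifferentiableAt (by simp)

/-- This reduces commutation of coordinate derivatives to the symmetry of the second derivative in
Euclidean space. The first-order identity is needed on a neighbourhood, since it gets
differentiated. -/
theorem mvfderiv_mvfderiv_coordFrame {x₀ y : M}
    (hy : y ∈ (chartAt (EuclideanSpace ℝ (Fin n)) x₀).source) {f : M → ℝ} (hf : SmoothFnAt n f y)
    (i j : Fin n) :
    mvfderiv (𝓡 n) (fun z ↦ mvfderiv (𝓡 n) f z (coordFrame x₀ j z)) y (coordFrame x₀ i y) =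
      fderiv ℝ (fderiv ℝ (f ∘ (extChartAt (𝓡 n) x₀).symm)) (extChartAt (𝓡 n) x₀ y)
        (EuclideanSpace.single i (1 : ℝ)) (EuclideanSpace.single j (1 : ℝ)) := by
  have hy' : y ∈ (extChartAt (𝓡 n) x₀).source := by simpa using hy
  have hs := smoothFnAt_mvfderiv hf (smoothFieldAt_coordFrame x₀ hy j)
  rw [mvfderiv_coordFrame hy hs.mdifferentiableAt]
  have h1 : ((fun z ↦ mvfderiv (𝓡 n) f z (coordFrame x₀ j z)) ∘ (extChartAt (𝓡 n) x₀).symm)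
      =ᶠ[nhds (extChartAt (𝓡 n) x₀ y)] fun w ↦ fderiv ℝ (f ∘ (extChartAt (𝓡 n) x₀).symm) w
        (EuclideanSpace.single j (1 : ℝ)) := by
    have hc : Filter.Tendsto (extChartAt (𝓡 n) x₀).symm (nhds (extChartAt (𝓡 n) x₀ y)) (nhds y) := by
      have := continuousAt_extChartAt_symm' (I := 𝓡 n) hy'
      rwa [ContinuousAt, (extChartAt (𝓡 n) x₀).left_inv hy'] at this
    filter_upwards [hc.eventually hf.eventually_mdifferentiableAt,
      (isOpen_extChartAt_target x₀).mem_nhds ((extChartAt (𝓡 n) x₀).map_source hy')] with w hw hw'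
    have hw2 : (extChartAt (𝓡 n) x₀).symm w ∈ (chartAt (EuclideanSpace ℝ (Fin n)) x₀).source := by
      simpa using (extChartAt (𝓡 n) x₀).map_target hw'
    simp only [Function.comp_apply]
    rw [mvfderiv_coordFrame hw2 hw, (extChartAt (𝓡 n) x₀).right_inv hw']
  rw [h1.fderiv_eq]
  have hd : DifferentiableAt ℝ (fderiv ℝ (f ∘ (extChartAt (𝓡 n) x₀).symm))
      (extChartAt (𝓡 n) x₀ y) :=
    ((contDiffAt_comp_extChartAt_symm hy hf).fderiv_right (m := 1)
      (WithTop.coe_le_coe.2 (le_top (a := (1 + 1 : ℕ∞))))).differentiableAt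
      (by simp)
  rw [fderiv_clm_apply hd (differentiableAt_const _)]
  simp

theorem mvfderiv_mvfderiv_coordFrame_comm {x₀ y : M}
    (hy : y ∈ (chartAt (EuclideanSpace ℝ (Fin n)) x₀).source) {f : M → ℝ} (hf : SmoothFnAt n f y)
    (i j : Fin n) :
    mvfderiv (𝓡 n) (fun z ↦ mvfderiv (𝓡 n) f z (coordFrame x₀ j z)) y (coordFrame x₀ i y) =
      mvfderiv (𝓡 n) (fun z ↦ mvfderiv (𝓡 n) f z (coordFrame x₀ i z)) y (coordFrame x₀ j y) := by
  rw [mvfderiv_mvfderiv_coordFrame hy hf, mvfderiv_mvfderiv_coordFrame hy hf]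
  exact (contDiffAt_comp_extChartAt_symm hy hf).isSymmSndFDerivAt
    (by simpa using WithTop.coe_le_coe.2 (le_top (a := (2 : ℕ∞)))) _ _

/-! ### The Levi-Civita connection -/

section
variable (g : RiemMetric n M) {x : M} {X Y Z : Π y : M, TangentSpace (𝓡 n) y}

theorem leviCivita_add (hX : FieldDiffAt X x) (hY : FieldDiffAt Y x) :
    leviCivita g (X + Y) x = leviCivita g X x + leviCivita g Y x :=
  (leviCivita g).isCovariantDerivativeOnUniv.add hX hY

theorem leviCivita_smul {f : M → ℝ} (hf : MDifferentiableAt (𝓡 n) 𝓘(ℝ, ℝ) f x)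
    (hX : FieldDiffAt X x) (v : TangentSpace (𝓡 n) x) :
    leviCivita g (f • X) x v = f x • leviCivita g X x v + mvfderiv (𝓡 n) f x v • X x := by
  rw [(leviCivita g).isCovariantDerivativeOnUniv.leibniz hX hf]
  simp

theorem leviCivita_sub (hX : FieldDiffAt X x) (hY : FieldDiffAt Y x) :
    leviCivita g (X - Y) x = leviCivita g X x - leviCivita g Y x := by
  have hXY : FieldDiffAt (X - Y) x := mdifferentiableAt_sub_section hX hY
  have h := leviCivita_add g hXY hY
  rw [sub_add_cancel] at h
  rw [h, add_sub_cancel_right]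

theorem leviCivita_congr (hY : FieldDiffAt Y x) (h : ∀ᶠ y in nhds x, X y = Y y) :
    leviCivita g X x = leviCivita g Y x :=
  (leviCivita g).isCovariantDerivativeOnUniv.congr_of_eventuallyEq
    (hY.congr_of_eventuallyEq (h.mono fun y hy ↦ by simp [hy])) hY Filter.univ_mem h

theorem leviCivita_sub_swap (hX : FieldDiffAt X x) (hY : FieldDiffAt Y x) :
    leviCivita g Y x (X x) - leviCivita g X x (Y x) = mlieBracket (𝓡 n) X Y x :=
  ((CovariantDerivative.torsion_eq_zero_iff _).1 (leviCivita_torsion g)) hX hY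

theorem leviCivita_metric_apply (hY : FieldDiffAt Y x) (hZ : FieldDiffAt Z x)
    (v : TangentSpace (𝓡 n) x) :
    mvfderiv (𝓡 n) (fun y ↦ g.inner y (Y y) (Z y)) x v =
      g.inner x (leviCivita g Y x v) (Z x) + g.inner x (Y x) (leviCivita g Z x v) := by
  simpa using leviCivita_metric g (smoothFieldAt_extend v).fieldDiffAt hY hZ

end

/-- The gradient of a function. -/
def grad (g : RiemMetric n M) (f : M → ℝ) : Π y : M, TangentSpace (𝓡 n) y :=
  fun y ↦ sharp g y (mvfderiv (𝓡 n) f y)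

theorem inner_grad (g : RiemMetric n M) (f : M → ℝ) (x : M) (v : TangentSpace (𝓡 n) x) :
    g.inner x (grad g f x) v = mvfderiv (𝓡 n) f x v :=
  inner_sharp g x _ v

/-- The Hessian of a smooth function is symmetric. -/
theorem hessian_symm (g : RiemMetric n M) {f : M → ℝ} {x : M} (hf : SmoothFnAt n f x)
    (v w : TangentSpace (𝓡 n) x) :
    g.inner x (leviCivita g (grad g f) x v) w = g.inner x (leviCivita g (grad g f) x w) v := by
  have hx := mem_chart_source (EuclideanSpace ℝ (Fin n)) x
  have hG : FieldDiffAt (grad g f) x := (smoothFieldAt_grad g hf).fieldDiffAt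
  -- By metric compatibility the left side is `e_i (e_j f) - ⟨grad f, ∇_{e_i} e_j⟩`. The first term
  -- is symmetric because partial derivatives commute, the second because the torsion and the
  -- brackets `[e_i, e_j]` vanish. Bilinearity then extends this from the frame to all vectors.
  have key : ∀ i j, g.inner x (leviCivita g (grad g f) x (coordFrame x i x)) (coordFrame x j x) =
      g.inner x (leviCivita g (grad g f) x (coordFrame x j x)) (coordFrame x i x) := by
    intro i j
    have hi := (smoothFieldAt_coordFrame x hx i).fieldDiffAt
    have hj := (smoothFieldAt_coordFrame x hx j).fieldDiffAt
    have h1 := leviCivita_metric_apply g hG hj (coordFrame x i x)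
    have h2 := leviCivita_metric_apply g hG hi (coordFrame x j x)
    simp only [inner_grad] at h1 h2
    have h3 := leviCivita_sub_swap g hi hj
    rw [mlieBracket_coordFrame hx, sub_eq_zero] at h3
    have h4 := mvfderiv_mvfderiv_coordFrame_comm hx hf i j
    rw [h3] at h1
    linarith
  have h1 : ∀ i w, g.inner x (leviCivita g (grad g f) x (coordFrame x i x)) w =
      g.inner x (leviCivita g (grad g f) x w) (coordFrame x i x) := by
    intro i w
    rw [← (coordBasis x hx).sum_repr w]
    simp only [map_sum, map_smul, sum_apply, smul_apply, ← coordFrame_eq, key]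
  rw [← (coordBasis x hx).sum_repr v]
  simp only [map_sum, map_smul, sum_apply, smul_apply, ← coordFrame_eq, h1]

/-- The Lie bracket is the commutator of derivations. -/
theorem mvfderiv_mlieBracket (g : RiemMetric n M) {f : M → ℝ} {x : M}
    {X Y : Π y : M, TangentSpace (𝓡 n) y} (hf : SmoothFnAt n f x) (hX : FieldDiffAt X x)
    (hY : FieldDiffAt Y x) :
    mvfderiv (𝓡 n) f x (mlieBracket (𝓡 n) X Y x) =
      mvfderiv (𝓡 n) (fun y ↦ mvfderiv (𝓡 n) f y (Y y)) x (X x) -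
        mvfderiv (𝓡 n) (fun y ↦ mvfderiv (𝓡 n) f y (X y)) x (Y x) := by
  have hG : FieldDiffAt (grad g f) x := (smoothFieldAt_grad g hf).fieldDiffAt
  -- The metric is auxiliary here. It turns `Yf` into `⟨grad f, Y⟩`; in the commutator the two
  -- Hessian terms cancel, leaving `⟨grad f, ∇_X Y - ∇_Y X⟩`.
  have h : ∀ y v, mvfderiv (𝓡 n) f y v = g.inner y (grad g f y) v := fun y v ↦
    (inner_grad g f y v).symm
  simp only [h]
  rw [leviCivita_metric_apply g hG hY, leviCivita_metric_apply g hG hX, hessian_symm g hf (X x),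
    ← leviCivita_sub_swap g hX hY, map_sub]
  ring

end

section

variable {n : ℕ} {M : Type*} [TopologicalSpace M] [ChartedSpace (EuclideanSpace ℝ (Fin n)) M]
  [IsManifold (𝓡 n) ∞ M]

/-! ### Tensoriality of the curvature -/

/-- An operation on vector fields smooth at `x` which is linear over the functions smooth at `x`
depends only on the value of the vector field at `x`. -/
theorem eq_of_tensorial {A : Type*} [AddCommGroup A] [Module ℝ A] {x : M}
    {Φ : (Π y : M, TangentSpace (𝓡 n) y) → A}
    (hadd : ∀ X Y, SmoothFieldAt X x → SmoothFieldAt Y x → Φ (X + Y) = Φ X + Φ Y)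
    (hsmul : ∀ (f : M → ℝ) X, SmoothFnAt n f x → SmoothFieldAt X x → Φ (f • X) = f x • Φ X)
    {X Y : Π y : M, TangentSpace (𝓡 n) y} (hX : SmoothFieldAt X x) (hY : SmoothFieldAt Y x)
    (h : X x = Y x) : Φ X = Φ Y := by
  classical
  have hx := mem_chart_source (EuclideanSpace ℝ (Fin n)) x
  have he := fun i ↦ smoothFieldAt_coordFrame x hx i
  have hzero : Φ 0 = 0 := by
    have := hsmul (fun _ ↦ 0) X contMDiffAt_const hX
    rw [zero_smul] at this
    rw [← this]
    congr 1
    ext1 y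
    simp
  -- A field vanishing at `x` is, near `x`, a combination of frame fields whose coefficients vanish
  -- at `x`.
  have key : ∀ Z, SmoothFieldAt Z x → Z x = 0 → Φ Z = 0 := by
    intro Z hZ hZ0
    have hc := (smoothFieldAt_iff_coordCoeff x Z hx).1 hZ
    have hs : ∀ s : Finset (Fin n), SmoothFieldAt (∑ i ∈ s, coordCoeff x Z i • coordFrame x i) x ∧
        Φ (∑ i ∈ s, coordCoeff x Z i • coordFrame x i) = 0 := by
      intro s
      induction s using Finset.induction_on with
      | empty =>
        simp only [Finset.sum_empty]
        refine ⟨?_, hzero⟩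
        have h0 : SmoothFieldAt (Z - Z) x := hZ.sub hZ
        rwa [sub_self] at h0
      | insert a s ha ih =>
        rw [Finset.sum_insert ha]
        have h1 : SmoothFieldAt (coordCoeff x Z a • coordFrame x a) x := (he a).smul (hc a)
        refine ⟨h1.add ih.1, ?_⟩
        rw [hadd _ _ h1 ih.1, ih.2, hsmul _ _ (hc a) (he a), coordCoeff, hZ0]
        simp
    obtain ⟨h1, h2⟩ := hs Finset.univ
    set Z' := ∑ i, coordCoeff x Z i • coordFrame x i with hZ'
    have hloc : ∀ᶠ y in nhds x, Z y = Z' y := by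
      filter_upwards [eventually_mem_chart_source hx] with y hy
      rw [eq_sum_coordCoeff x Z hy, hZ', Finset.sum_apply]
      rfl
    -- `Z` and `Z'` agree only near `x`, while `Φ` sees global fields. Smoothness is required only
    -- at `x`, so the indicator of the agreement set serves as cutoff: it is locally constant there,
    -- and it makes the two fields equal everywhere.
    let ψ : M → ℝ := fun y ↦ if Z y = Z' y then 1 else 0
    have hψ : SmoothFnAt n ψ x := by
      refine ContMDiffAt.congr_of_eventuallyEq (contMDiffAt_const (c := (1 : ℝ))) ?_
      exact hloc.mono fun y hy ↦ by simp [ψ, hy]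
    have hψx : ψ x = 1 := by simp [ψ, hloc.self_of_nhds]
    have hψZ : ψ • Z = ψ • Z' := by
      ext1 y
      by_cases hy : Z y = Z' y <;> simp [ψ, hy]
    have e1 := hsmul ψ Z hψ hZ
    have e2 := hsmul ψ Z' hψ h1
    rw [hψx, one_smul] at e1 e2
    rw [← e1, hψZ, e2, h2]
  have h1 := hadd (X - Y) Y (hX.sub hY) hY
  rw [sub_add_cancel, key (X - Y) (hX.sub hY) (by simp [h]), zero_add] at h1
  exact h1

section curvature
variable (g : RiemMetric n M) {x : M} {X X' Y Z Z' : Π y : M, TangentSpace (𝓡 n) y}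

theorem curvatureField_swap : curvatureField g X Y Z x = -curvatureField g Y X Z x := by
  simp only [curvatureField, mlieBracket_swap_apply (V := X) (W := Y), map_neg]
  abel

theorem curvatureField_add_left (hX : SmoothFieldAt X x) (hX' : SmoothFieldAt X' x)
    (hZ : SmoothFieldAt Z x) :
    curvatureField g (X + X') Y Z x = curvatureField g X Y Z x + curvatureField g X' Y Z x := by
  have h : (fun y ↦ leviCivita g Z y ((X + X') y)) =
      (fun y ↦ leviCivita g Z y (X y)) + (fun y ↦ leviCivita g Z y (X' y)) := by
    ext1 y; simp
  rw [curvatureField, h, leviCivita_add g (smoothFieldAt_leviCivita g hX hZ).fieldDiffAt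
    (smoothFieldAt_leviCivita g hX' hZ).fieldDiffAt,
    mlieBracket_add_left hX.fieldDiffAt hX'.fieldDiffAt]
  simp only [curvatureField, Pi.add_apply, map_add, add_apply]
  abel

/-- The term `(Yf) ∇_X Z` from differentiating `f ∇_X Z` cancels the one from `[fX, Y] = f [X, Y] -
(Yf) X`. -/
theorem curvatureField_smul_left {f : M → ℝ} (hf : SmoothFnAt n f x) (hX : SmoothFieldAt X x)
    (hZ : SmoothFieldAt Z x) :
    curvatureField g (f • X) Y Z x = f x • curvatureField g X Y Z x := by
  have h : (fun y ↦ leviCivita g Z y ((f • X) y)) = f • (fun y ↦ leviCivita g Z y (X y)) := by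
    ext1 y; simp
  simp only [curvatureField, h, leviCivita_smul g hf.mdifferentiableAt
    (smoothFieldAt_leviCivita g hX hZ).fieldDiffAt,
    mlieBracket_smul_left hf.mdifferentiableAt hX.fieldDiffAt]
  simp
  module

theorem curvatureField_add_right (hX : SmoothFieldAt X x) (hY : SmoothFieldAt Y x)
    (hZ : SmoothFieldAt Z x) (hZ' : SmoothFieldAt Z' x) :
    curvatureField g X Y (Z + Z') x = curvatureField g X Y Z x + curvatureField g X Y Z' x := by
  have h : ∀ W, SmoothFieldAt W x → leviCivita g (fun y ↦ leviCivita g (Z + Z') y (W y)) x =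
      leviCivita g (fun y ↦ leviCivita g Z y (W y)) x +
        leviCivita g (fun y ↦ leviCivita g Z' y (W y)) x := by
    intro W hW
    have h1 := smoothFieldAt_leviCivita g hW hZ
    have h2 := smoothFieldAt_leviCivita g hW hZ'
    rw [← leviCivita_add g h1.fieldDiffAt h2.fieldDiffAt]
    refine leviCivita_congr g (h1.add h2).fieldDiffAt ?_
    filter_upwards [hZ.eventually_fieldDiffAt, hZ'.eventually_fieldDiffAt] with y e1 e2
    rw [leviCivita_add g e1 e2]
    rfl
  simp only [curvatureField, h X hX, h Y hY, leviCivita_add g hZ.fieldDiffAt hZ'.fieldDiffAt,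
    add_apply]
  abel

/-- The terms with two first-order factors are symmetric in `X` and `Y` and drop out. The second
derivatives of `f` leave `X(Yf) - Y(Xf) - [X, Y]f`, which vanishes. -/
theorem curvatureField_smul_right {f : M → ℝ} (hf : SmoothFnAt n f x) (hX : SmoothFieldAt X x)
    (hY : SmoothFieldAt Y x) (hZ : SmoothFieldAt Z x) :
    curvatureField g X Y (f • Z) x = f x • curvatureField g X Y Z x := by
  have h : ∀ W, SmoothFieldAt W x → ∀ v,
      leviCivita g (fun y ↦ leviCivita g (f • Z) y (W y)) x v =
      f x • leviCivita g (fun y ↦ leviCivita g Z y (W y)) x v +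
        mvfderiv (𝓡 n) f x v • leviCivita g Z x (W x) +
        (mvfderiv (𝓡 n) f x (W x) • leviCivita g Z x v +
        mvfderiv (𝓡 n) (fun y ↦ mvfderiv (𝓡 n) f y (W y)) x v • Z x) := by
    intro W hW v
    have h1 := smoothFieldAt_leviCivita g hW hZ
    have h2 := smoothFnAt_mvfderiv hf hW
    have h3 := h1.smul hf
    have h4 := hZ.smul h2
    rw [← leviCivita_smul g hf.mdifferentiableAt h1.fieldDiffAt,
      ← leviCivita_smul g h2.mdifferentiableAt hZ.fieldDiffAt, ← add_apply,
      ← leviCivita_add g h3.fieldDiffAt h4.fieldDiffAt]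
    refine congrArg (fun A ↦ A v) (leviCivita_congr g (h3.add h4).fieldDiffAt ?_)
    filter_upwards [hZ.eventually_fieldDiffAt, hf.eventually_mdifferentiableAt] with y e1 e2
    rw [leviCivita_smul g e2 e1]
    rfl
  simp only [curvatureField, h X hX, h Y hY, leviCivita_smul g hf.mdifferentiableAt hZ.fieldDiffAt,
    mvfderiv_mlieBracket g hf hX.fieldDiffAt hY.fieldDiffAt]
  module

/-- Tensoriality replaces the chosen extensions one slot at a time, the middle slot through
antisymmetry. Smooth frames may therefore be used to compute the curvature. -/
theorem riemann_eq_curvatureField (hX : SmoothFieldAt X x) (hY : SmoothFieldAt Y x)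
    (hZ : SmoothFieldAt Z x) : riemann g x (X x) (Y x) (Z x) = curvatureField g X Y Z x := by
  have eX := smoothFieldAt_extend (X x)
  have eY := smoothFieldAt_extend (Y x)
  have eZ := smoothFieldAt_extend (Z x)
  have h1 : curvatureField g (extend (EuclideanSpace ℝ (Fin n)) (X x))
      (extend (EuclideanSpace ℝ (Fin n)) (Y x)) (extend (EuclideanSpace ℝ (Fin n)) (Z x)) x =
      curvatureField g X (extend (EuclideanSpace ℝ (Fin n)) (Y x))
        (extend (EuclideanSpace ℝ (Fin n)) (Z x)) x :=
    eq_of_tensorial (Φ := fun X ↦ curvatureField g X _ _ x)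
      (fun _ _ h h' ↦ curvatureField_add_left g h h' eZ)
      (fun _ _ hf h ↦ curvatureField_smul_left g hf h eZ) eX hX (by simp)
  have h2 : curvatureField g (extend (EuclideanSpace ℝ (Fin n)) (Y x)) X
      (extend (EuclideanSpace ℝ (Fin n)) (Z x)) x =
      curvatureField g Y X (extend (EuclideanSpace ℝ (Fin n)) (Z x)) x :=
    eq_of_tensorial (Φ := fun Y ↦ curvatureField g Y _ _ x)
      (fun _ _ h h' ↦ curvatureField_add_left g h h' eZ)
      (fun _ _ hf h ↦ curvatureField_smul_left g hf h eZ) eY hY (by simp)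
  have h3 : curvatureField g X Y (extend (EuclideanSpace ℝ (Fin n)) (Z x)) x =
      curvatureField g X Y Z x :=
    eq_of_tensorial (Φ := fun Z ↦ curvatureField g X Y Z x)
      (fun _ _ h h' ↦ curvatureField_add_right g hX hY h h')
      (fun _ _ hf h ↦ curvatureField_smul_right g hf hX hY h) eZ hZ (by simp)
  rw [riemann, h1, curvatureField_swap, h2, ← curvatureField_swap, h3]

theorem riemann_swap (u v w : TangentSpace (𝓡 n) x) : riemann g x u v w = -riemann g x v u w :=
  curvatureField_swap g

theorem riemann_add_left (u u' v w : TangentSpace (𝓡 n) x) :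
    riemann g x (u + u') v w = riemann g x u v w + riemann g x u' v w := by
  have hu := smoothFieldAt_extend u
  have hu' := smoothFieldAt_extend u'
  have hv := smoothFieldAt_extend v
  have hw := smoothFieldAt_extend w
  have h := riemann_eq_curvatureField g (hu.add hu') hv hw
  rw [curvatureField_add_left g hu hu' hw] at h
  simp only [Pi.add_apply, extend_apply_self] at h
  exact h

theorem riemann_smul_left (c : ℝ) (u v w : TangentSpace (𝓡 n) x) :
    riemann g x (c • u) v w = c • riemann g x u v w := by
  have hu := smoothFieldAt_extend u
  have hv := smoothFieldAt_extend v
  have hw := smoothFieldAt_extend w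
  have hc : SmoothFnAt n (fun _ : M ↦ c) x := contMDiffAt_const
  have h := riemann_eq_curvatureField g (hu.smul hc) hv hw
  rw [curvatureField_smul_left g hc hu hw] at h
  simp only [Pi.smul_apply', extend_apply_self] at h
  exact h

theorem riemann_add_right (u v w w' : TangentSpace (𝓡 n) x) :
    riemann g x u v (w + w') = riemann g x u v w + riemann g x u v w' := by
  have hu := smoothFieldAt_extend u
  have hv := smoothFieldAt_extend v
  have hw := smoothFieldAt_extend w
  have hw' := smoothFieldAt_extend w'
  have h := riemann_eq_curvatureField g hu hv (hw.add hw')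
  rw [curvatureField_add_right g hu hv hw hw'] at h
  simp only [Pi.add_apply, extend_apply_self] at h
  exact h

theorem riemann_smul_right (c : ℝ) (u v w : TangentSpace (𝓡 n) x) :
    riemann g x u v (c • w) = c • riemann g x u v w := by
  have hu := smoothFieldAt_extend u
  have hv := smoothFieldAt_extend v
  have hw := smoothFieldAt_extend w
  have hc : SmoothFnAt n (fun _ : M ↦ c) x := contMDiffAt_const
  have h := riemann_eq_curvatureField g hu hv (hw.smul hc)
  rw [curvatureField_smul_right g hc hu hv hw] at h
  simp only [Pi.smul_apply', extend_apply_self] at h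
  exact h

/-- The curvature endomorphism `X ↦ R(X, Y) Z`, whose trace is the Ricci tensor. -/
def riemannEnd (v w : TangentSpace (𝓡 n) x) :
    TangentSpace (𝓡 n) x →ₗ[ℝ] TangentSpace (𝓡 n) x where
  toFun u := riemann g x u v w
  map_add' u u' := riemann_add_left g u u' v w
  map_smul' c u := riemann_smul_left g c u v w

/-- The Ricci tensor as a bilinear map. -/
def ricciHom (x : M) : TangentSpace (𝓡 n) x →ₗ[ℝ] TangentSpace (𝓡 n) x →ₗ[ℝ] ℝ :=
  LinearMap.mk₂ ℝ (ricci g x)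
    (fun v v' w ↦ by
      simp only [ricci, riemann_swap g _ (v + v'), riemann_add_left, riemann_swap g _ v,
        riemann_swap g _ v', neg_add, map_add, Finset.sum_add_distrib])
    (fun c v w ↦ by
      simp only [ricci, riemann_swap g _ (c • v), riemann_smul_left, riemann_swap g _ v,
        smul_neg, map_neg, map_smul, Finset.smul_sum])
    (fun v w w' ↦ by
      simp only [ricci, riemann_add_right, map_add, Finset.sum_add_distrib])
    (fun c v w ↦ by
      simp only [ricci, riemann_smul_right, map_smul, Finset.smul_sum])

theorem ricciHom_apply (v w : TangentSpace (𝓡 n) x) : ricciHom g x v w = ricci g x v w := rfl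

end curvature

/-! ### Traces -/

/-- The basis `stdVec` of the tangent space. -/
def stdBasis (x : M) : Module.Basis (Fin n) ℝ (TangentSpace (𝓡 n) x) :=
  (EuclideanSpace.basisFun (Fin n) ℝ).toBasis

theorem stdBasis_apply (x : M) (i : Fin n) : stdBasis x i = stdVec x i := by
  change (EuclideanSpace.basisFun (Fin n) ℝ).toBasis i = EuclideanSpace.single i (1 : ℝ)
  simp

theorem stdBasis_repr (x : M) (i : Fin n) (v : TangentSpace (𝓡 n) x) :
    (stdBasis x).repr v i = stdCovec x i v := rfl

theorem sum_stdCovec_smul_stdVec (x : M) (v : TangentSpace (𝓡 n) x) :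
    ∑ i, stdCovec x i v • stdVec x i = v := by
  conv_rhs => rw [← (stdBasis x).sum_repr v]
  simp only [stdBasis_apply, stdBasis_repr]

theorem trace_eq_sum_repr {x : M} (A : TangentSpace (𝓡 n) x →ₗ[ℝ] TangentSpace (𝓡 n) x)
    (b : Module.Basis (Fin n) ℝ (TangentSpace (𝓡 n) x)) :
    LinearMap.trace ℝ (TangentSpace (𝓡 n) x) A = ∑ i, b.repr (A (b i)) i := by
  rw [LinearMap.trace_eq_matrix_trace ℝ b, Matrix.trace]
  simp [LinearMap.toMatrix_apply]

theorem trace_eq_sum_stdCovec {x : M} (A : TangentSpace (𝓡 n) x →ₗ[ℝ] TangentSpace (𝓡 n) x) :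
    LinearMap.trace ℝ (TangentSpace (𝓡 n) x) A = ∑ i, stdCovec x i (A (stdVec x i)) := by
  rw [trace_eq_sum_repr A (stdBasis x)]
  simp only [stdBasis_apply, stdBasis_repr]

theorem ricci_eq_trace (g : RiemMetric n M) {x : M} (v w : TangentSpace (𝓡 n) x) :
    ricci g x v w = LinearMap.trace ℝ (TangentSpace (𝓡 n) x) (riemannEnd g v w) := by
  rw [trace_eq_sum_stdCovec]
  rfl

theorem inner_sharp_right (g : RiemMetric n M) (x : M) (θ : TangentSpace (𝓡 n) x →L[ℝ] ℝ)
    (v : TangentSpace (𝓡 n) x) : g.inner x v (sharp g x θ) = θ v := by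
  rw [g.symm, inner_sharp]

/-- Pairing with `(e^i)^♯` is evaluation of `e^i`, so the metric drops out. The right-hand side no
longer involves a basis. -/
theorem metricTrace_inner (g : RiemMetric n M) {x : M}
    (A : TangentSpace (𝓡 n) x →ₗ[ℝ] TangentSpace (𝓡 n) x) :
    metricTrace g x (fun v w ↦ g.inner x (A v) w) =
      LinearMap.trace ℝ (TangentSpace (𝓡 n) x) A := by
  simp only [metricTrace, trace_eq_sum_stdCovec, inner_sharp_right]

/-- Metric compatibility lets index raising commute with `∇`, so forms can be handled as vector
fields from here on. -/
theorem covForm_eq (g : RiemMetric n M) {u : Form n M} {x : M}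
    (hu : FieldDiffAt (fun y ↦ sharp g y (u y)) x) (v w : TangentSpace (𝓡 n) x) :
    covForm g u x v w = g.inner x (leviCivita g (fun y ↦ sharp g y (u y)) x v) w := by
  have hw := (smoothFieldAt_extend w).fieldDiffAt
  have h := leviCivita_metric_apply g hu hw v
  simp only [inner_sharp, extend_apply_self] at h
  rw [covForm, h, add_sub_cancel_right]

theorem divergence_eq_trace (g : RiemMetric n M) {u : Form n M} {x : M}
    (hu : FieldDiffAt (fun y ↦ sharp g y (u y)) x) :
    divergence g u x = LinearMap.trace ℝ (TangentSpace (𝓡 n) x)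
      (leviCivita g (fun y ↦ sharp g y (u y)) x).toLinearMap := by
  rw [divergence, ← metricTrace_inner]
  exact congrArg _ (funext₂ fun v w ↦ covForm_eq g hu v w)

end

section

variable {n : ℕ} {M : Type*} [TopologicalSpace M] [ChartedSpace (EuclideanSpace ℝ (Fin n)) M]
  [IsManifold (𝓡 n) ∞ M]

/-! ### Conformal change of the metric -/

theorem mvfderiv_exp_mul {Υ : M → ℝ} {x : M} (hΥ : MDifferentiableAt (𝓡 n) 𝓘(ℝ, ℝ) Υ x) (c : ℝ)
    (v : TangentSpace (𝓡 n) x) :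
    mvfderiv (𝓡 n) (fun y ↦ Real.exp (c * Υ y)) x v =
      c * Real.exp (c * Υ x) * mvfderiv (𝓡 n) Υ x v := by
  have h1 : HasDerivAt (fun t : ℝ ↦ Real.exp (c * t)) (c * Real.exp (c * Υ x)) (Υ x) := by
    have := ((hasDerivAt_id (Υ x)).const_mul c).exp
    simpa [mul_comm] using this
  have h2 := h1.hasFDerivAt.hasMFDerivAt.comp x hΥ.hasMFDerivAt
  have h3 : mfderiv (𝓡 n) 𝓘(ℝ, ℝ) (fun y ↦ Real.exp (c * Υ y)) x = _ := h2.mfderiv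
  change mfderiv (𝓡 n) 𝓘(ℝ, ℝ) (fun y ↦ Real.exp (c * Υ y)) x v = _
  rw [h3]
  change (ContinuousLinearMap.toSpanSingleton ℝ (c * Real.exp (c * Υ x)))
    (mvfderiv (𝓡 n) Υ x v) = _
  simp [mul_comm]

theorem smoothFnAt_exp_mul {Υ : M → ℝ} {x : M} (hΥ : SmoothFnAt n Υ x) (c : ℝ) :
    SmoothFnAt n (fun y ↦ Real.exp (c * Υ y)) x :=
  (Real.contDiff_exp.comp (contDiff_const.mul contDiff_id)).contMDiff.contMDiffAt.comp x hΥ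

section rescale
variable (g : RiemMetric n M) {Υ : M → ℝ} (hΥ : ContMDiff (𝓡 n) 𝓘(ℝ, ℝ) ∞ Υ) {x : M}
  {X Y Z : Π y : M, TangentSpace (𝓡 n) y}

theorem rescale_inner (x : M) (v w : TangentSpace (𝓡 n) x) :
    (rescale g Υ hΥ).inner x v w = Real.exp (2 * Υ x) * g.inner x v w := rfl

theorem sharp_rescale (x : M) (θ : TangentSpace (𝓡 n) x →L[ℝ] ℝ) :
    sharp (rescale g Υ hΥ) x θ = Real.exp (-2 * Υ x) • sharp g x θ := by
  refine eq_of_inner_eq (rescale g Υ hΥ) fun z ↦ ?_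
  rw [inner_sharp, rescale_inner, map_smul, smul_apply, inner_sharp, smul_eq_mul, ← mul_assoc,
    ← Real.exp_add]
  simp

/-- In the Koszul formula every term acquires the factor `e^{2Υ}`; the three derivative terms also
differentiate it, which accounts for the three added terms. -/
theorem leviCivita_rescale (hY : FieldDiffAt Y x) (v : TangentSpace (𝓡 n) x) :
    leviCivita (rescale g Υ hΥ) Y x v = leviCivita g Y x v +
      (g.inner x (grad g Υ x) v • Y x + g.inner x (grad g Υ x) (Y x) • v
        - g.inner x v (Y x) • grad g Υ x) := by
  have hΥx := (hΥ x).mdifferentiableAt (by simp)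
  have hE : MDifferentiableAt (𝓡 n) 𝓘(ℝ, ℝ) (fun y ↦ Real.exp (2 * Υ y)) x :=
    (smoothFnAt_exp_mul (hΥ x) 2).mdifferentiableAt
  refine eq_of_inner_eq (rescale g Υ hΥ) fun z ↦ ?_
  have hv := (smoothFieldAt_extend v).fieldDiffAt
  have hz := (smoothFieldAt_extend z).fieldDiffAt
  have d : ∀ {U V : Π y : M, TangentSpace (𝓡 n) y} (w : TangentSpace (𝓡 n) x),
      FieldDiffAt U x → FieldDiffAt V x →
      mvfderiv (𝓡 n) (fun y ↦ (rescale g Υ hΥ).inner y (U y) (V y)) x w =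
        Real.exp (2 * Υ x) * (mvfderiv (𝓡 n) (fun y ↦ g.inner y (U y) (V y)) x w +
          2 * mvfderiv (𝓡 n) Υ x w * g.inner x (U x) (V x)) := by
    intro U V w hU hV
    have e : (fun y ↦ (rescale g Υ hΥ).inner y (U y) (V y)) =
        (fun y ↦ Real.exp (2 * Υ y)) * fun y ↦ g.inner y (U y) (V y) := rfl
    rw [e, mvfderiv_mul hE (mdifferentiableAt_inner g hU hV)]
    simp only [add_apply, smul_apply, smul_eq_mul, mvfderiv_exp_mul hΥx]
    ring
  have h1 := inner_leviCivita (rescale g Υ hΥ) hv hY hz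
  have h2 := inner_leviCivita g hv hY hz
  rw [koszul, d _ hY hz, d _ hv hz, d _ hv hY] at h1
  simp only [koszul, extend_apply_self, rescale_inner] at h1 h2
  rw [rescale_inner, h1, rescale_inner]
  simp only [map_add, map_sub, map_smul, add_apply, sub_apply, smul_apply, smul_eq_mul, h2,
    inner_grad]
  ring

/-- The term which a conformal change adds to the Levi-Civita connection. -/
def conformalTerm (G Y Z : Π y : M, TangentSpace (𝓡 n) y) : Π y : M, TangentSpace (𝓡 n) y :=
  (fun y ↦ g.inner y (G y) (Y y)) • Z + (fun y ↦ g.inner y (G y) (Z y)) • Y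
    - (fun y ↦ g.inner y (Y y) (Z y)) • G

theorem smoothFieldAt_conformalTerm {G : Π y : M, TangentSpace (𝓡 n) y} (hG : SmoothFieldAt G x)
    (hY : SmoothFieldAt Y x) (hZ : SmoothFieldAt Z x) :
    SmoothFieldAt (conformalTerm g G Y Z) x :=
  ((hZ.smul (smoothFnAt_inner g hG hY)).add (hY.smul (smoothFnAt_inner g hG hZ))).sub
    (hG.smul (smoothFnAt_inner g hY hZ))

theorem leviCivita_conformalTerm {G : Π y : M, TangentSpace (𝓡 n) y} (hG : SmoothFieldAt G x)
    (hY : SmoothFieldAt Y x) (hZ : SmoothFieldAt Z x) (v : TangentSpace (𝓡 n) x) :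
    leviCivita g (conformalTerm g G Y Z) x v =
      (g.inner x (G x) (Y x) • leviCivita g Z x v +
        (g.inner x (leviCivita g G x v) (Y x) + g.inner x (G x) (leviCivita g Y x v)) • Z x) +
      (g.inner x (G x) (Z x) • leviCivita g Y x v +
        (g.inner x (leviCivita g G x v) (Z x) + g.inner x (G x) (leviCivita g Z x v)) • Y x) -
      (g.inner x (Y x) (Z x) • leviCivita g G x v +
        (g.inner x (leviCivita g Y x v) (Z x) + g.inner x (Y x) (leviCivita g Z x v)) • G x) := by
  have h1 := smoothFnAt_inner g hG hY
  have h2 := smoothFnAt_inner g hG hZ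
  have h3 := smoothFnAt_inner g hY hZ
  have s1 := hZ.smul h1
  have s2 := hY.smul h2
  have s3 := hG.smul h3
  rw [conformalTerm, leviCivita_sub g (s1.add s2).fieldDiffAt s3.fieldDiffAt,
    leviCivita_add g s1.fieldDiffAt s2.fieldDiffAt, sub_apply, add_apply,
    leviCivita_smul g h1.mdifferentiableAt hZ.fieldDiffAt,
    leviCivita_smul g h2.mdifferentiableAt hY.fieldDiffAt,
    leviCivita_smul g h3.mdifferentiableAt hG.fieldDiffAt,
    leviCivita_metric_apply g hG.fieldDiffAt hY.fieldDiffAt,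
    leviCivita_metric_apply g hG.fieldDiffAt hZ.fieldDiffAt,
    leviCivita_metric_apply g hY.fieldDiffAt hZ.fieldDiffAt]

/-- The formula for the rescaled connection is applied twice. Inside the outer derivative it is
needed near `x`, hence the passage through local equality. -/
theorem leviCivita_leviCivita_rescale (hY : SmoothFieldAt Y x) (hZ : SmoothFieldAt Z x)
    (v : TangentSpace (𝓡 n) x) :
    leviCivita (rescale g Υ hΥ) (fun y ↦ leviCivita (rescale g Υ hΥ) Z y (Y y)) x v =
      leviCivita g (fun y ↦ leviCivita g Z y (Y y)) x v +
        leviCivita g (conformalTerm g (grad g Υ) Y Z) x v +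
      (g.inner x (grad g Υ x) v • (leviCivita g Z x (Y x) + conformalTerm g (grad g Υ) Y Z x) +
        g.inner x (grad g Υ x) (leviCivita g Z x (Y x) + conformalTerm g (grad g Υ) Y Z x) • v
        - g.inner x v (leviCivita g Z x (Y x) + conformalTerm g (grad g Υ) Y Z x) •
          grad g Υ x) := by
  have hG : SmoothFieldAt (grad g Υ) x := smoothFieldAt_grad g (hΥ x)
  have h1 := smoothFieldAt_leviCivita g hY hZ
  have h2 := smoothFieldAt_conformalTerm g hG hY hZ
  have h3 := (h1.add h2).fieldDiffAt
  have e := leviCivita_congr (rescale g Υ hΥ) h3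
    (X := fun y ↦ leviCivita (rescale g Υ hΥ) Z y (Y y)) (by
      filter_upwards [hZ.eventually_fieldDiffAt] with y hy
      rw [leviCivita_rescale g hΥ hy]
      rfl)
  rw [e, leviCivita_rescale g hΥ h3, leviCivita_add g h1.fieldDiffAt h2.fieldDiffAt]
  rfl

/-- All derivatives of `Y` and `Z` outside the original curvature cancel once the bracket is written
as `∇_X Y - ∇_Y X`. The Hessian term multiplying `Z` disappears because the Hessian of `Υ` is
symmetric. -/
theorem curvatureField_rescale (hX : SmoothFieldAt X x) (hY : SmoothFieldAt Y x)
    (hZ : SmoothFieldAt Z x) :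
    curvatureField (rescale g Υ hΥ) X Y Z x = curvatureField g X Y Z x
      + (g.inner x (leviCivita g (grad g Υ) x (X x)) (Z x) • Y x
        - g.inner x (leviCivita g (grad g Υ) x (Y x)) (Z x) • X x
        - g.inner x (Y x) (Z x) • leviCivita g (grad g Υ) x (X x)
        + g.inner x (X x) (Z x) • leviCivita g (grad g Υ) x (Y x)
        + (g.inner x (grad g Υ x) (Y x) * g.inner x (grad g Υ x) (Z x)
            - g.inner x (Y x) (Z x) * g.inner x (grad g Υ x) (grad g Υ x)) • X x
        - (g.inner x (grad g Υ x) (X x) * g.inner x (grad g Υ x) (Z x)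
            - g.inner x (X x) (Z x) * g.inner x (grad g Υ x) (grad g Υ x)) • Y x
        + (g.inner x (grad g Υ x) (X x) * g.inner x (Y x) (Z x)
            - g.inner x (grad g Υ x) (Y x) * g.inner x (X x) (Z x)) • grad g Υ x) := by
  have hG : SmoothFieldAt (grad g Υ) x := smoothFieldAt_grad g (hΥ x)
  have hH := hessian_symm g (hΥ x) (X x) (Y x)
  rw [curvatureField, leviCivita_leviCivita_rescale g hΥ hY hZ,
    leviCivita_leviCivita_rescale g hΥ hX hZ, leviCivita_rescale g hΥ hZ.fieldDiffAt,
    leviCivita_conformalTerm g hG hY hZ, leviCivita_conformalTerm g hG hX hZ, curvatureField,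
    ← leviCivita_sub_swap g hX.fieldDiffAt hY.fieldDiffAt]
  simp only [conformalTerm, Pi.add_apply, Pi.sub_apply, Pi.smul_apply', map_add, map_sub, map_smul,
    sub_apply, smul_eq_mul, hH, g.symm x (Y x) (X x),
    g.symm x (X x) (grad g Υ x), g.symm x (Y x) (grad g Υ x)]
  module

end rescale

end

/-! ### Rank-one traces and the divergence of a vector field. -/

section

variable {n : ℕ} {M : Type*} [TopologicalSpace M] [ChartedSpace (EuclideanSpace ℝ (Fin n)) M]
  [IsManifold (𝓡 n) ∞ M]

theorem sum_mul_stdCovec {x : M} (φ : TangentSpace (𝓡 n) x →L[ℝ] ℝ) (v : TangentSpace (𝓡 n) x) :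
    ∑ i, φ (stdVec x i) * stdCovec x i v = φ v := by
  conv_rhs => rw [← sum_stdCovec_smul_stdVec x v]
  simp only [map_sum, map_smul, smul_eq_mul, mul_comm]

theorem sum_stdCovec_stdVec (x : M) : ∑ i : Fin n, stdCovec x i (stdVec x i) = n := by
  have : ∀ i : Fin n, stdCovec x i (stdVec x i) = 1 := fun i ↦ by
    rw [← stdBasis_repr, ← stdBasis_apply]
    simp
  simp [this]

/-- A rank-one map `v ↦ φ v • w` has trace `φ w`. This is the extra term in the product rule for the
divergence. -/
theorem trace_add_rankOne {x : M} (A : TangentSpace (𝓡 n) x →L[ℝ] TangentSpace (𝓡 n) x)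
    (φ : TangentSpace (𝓡 n) x →L[ℝ] ℝ) (w : TangentSpace (𝓡 n) x) (c : ℝ)
    {B : TangentSpace (𝓡 n) x →L[ℝ] TangentSpace (𝓡 n) x} (h : ∀ v, B v = c • A v + φ v • w) :
    LinearMap.trace ℝ (TangentSpace (𝓡 n) x) B.toLinearMap =
      c * LinearMap.trace ℝ (TangentSpace (𝓡 n) x) A.toLinearMap + φ w := by
  rw [trace_eq_sum_stdCovec, trace_eq_sum_stdCovec, ← sum_mul_stdCovec φ w, Finset.mul_sum,
    ← Finset.sum_add_distrib]
  refine Finset.sum_congr rfl fun i _ ↦ ?_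
  simp [h]

/-- The divergence of a vector field. -/
def fieldDiv (g : RiemMetric n M) (X : Π y : M, TangentSpace (𝓡 n) y) (x : M) : ℝ :=
  LinearMap.trace ℝ (TangentSpace (𝓡 n) x) (leviCivita g X x).toLinearMap

theorem fieldDiv_smul (g : RiemMetric n M) {f : M → ℝ} {X : Π y : M, TangentSpace (𝓡 n) y} {x : M}
    (hf : MDifferentiableAt (𝓡 n) 𝓘(ℝ, ℝ) f x) (hX : FieldDiffAt X x) :
    fieldDiv g (f • X) x = f x * fieldDiv g X x + mvfderiv (𝓡 n) f x (X x) :=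
  trace_add_rankOne _ _ _ _ fun v ↦ leviCivita_smul g hf hX v

theorem fieldDiv_add (g : RiemMetric n M) {X Y : Π y : M, TangentSpace (𝓡 n) y} {x : M}
    (hX : FieldDiffAt X x) (hY : FieldDiffAt Y x) :
    fieldDiv g (X + Y) x = fieldDiv g X x + fieldDiv g Y x := by
  simp [fieldDiv, leviCivita_add g hX hY]

theorem fieldDiv_sub (g : RiemMetric n M) {X Y : Π y : M, TangentSpace (𝓡 n) y} {x : M}
    (hX : FieldDiffAt X x) (hY : FieldDiffAt Y x) :
    fieldDiv g (X - Y) x = fieldDiv g X x - fieldDiv g Y x := by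
  simp [fieldDiv, leviCivita_sub g hX hY]

theorem fieldDiv_congr (g : RiemMetric n M) {X Y : Π y : M, TangentSpace (𝓡 n) y} {x : M}
    (hY : FieldDiffAt Y x) (h : ∀ᶠ y in nhds x, X y = Y y) : fieldDiv g X x = fieldDiv g Y x := by
  simp [fieldDiv, leviCivita_congr g hY h]

theorem divergence_eq_fieldDiv (g : RiemMetric n M) {u : Form n M} {x : M}
    (hu : FieldDiffAt (fun y ↦ sharp g y (u y)) x) :
    divergence g u x = fieldDiv g (fun y ↦ sharp g y (u y)) x :=
  divergence_eq_trace g hu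

/-- The basis `stdVec` comes from the preferred chart of each point and need not vary continuously.
Smoothness of a trace has to be read off in the frame of one fixed chart. -/
theorem fieldDiv_eq_sum_coordCoeff (g : RiemMetric n M) (X : Π y : M, TangentSpace (𝓡 n) y)
    {x₀ x : M} (hx : x ∈ (chartAt (EuclideanSpace ℝ (Fin n)) x₀).source) :
    fieldDiv g X x = ∑ i, coordCoeff x₀ (fun y ↦ leviCivita g X y (coordFrame x₀ i y)) i x := by
  rw [fieldDiv, trace_eq_sum_repr _ (coordBasis x₀ hx)]
  refine Finset.sum_congr rfl fun i _ ↦ ?_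
  rw [coordCoeff_eq _ _ _ hx, coordFrame_eq x₀ hx]
  rfl

theorem smoothFnAt_fieldDiv (g : RiemMetric n M) {X : Π y : M, TangentSpace (𝓡 n) y} {x : M}
    (hX : SmoothFieldAt X x) : SmoothFnAt n (fieldDiv g X) x := by
  have hx := mem_chart_source (EuclideanSpace ℝ (Fin n)) x
  have h : SmoothFnAt n
      (fun y ↦ ∑ i, coordCoeff x (fun y ↦ leviCivita g X y (coordFrame x i y)) i y) x := by
    refine SmoothFnAt.sum fun i _ ↦ ?_
    exact (smoothFieldAt_iff_coordCoeff x _ hx).1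
      (smoothFieldAt_leviCivita g (smoothFieldAt_coordFrame x hx i) hX) i
  refine ContMDiffAt.congr_of_eventuallyEq h ?_
  filter_upwards [eventually_mem_chart_source hx] with y hy
  exact fieldDiv_eq_sum_coordCoeff g X hy

/-! ### Ricci curvature, scalar curvature and divergence under rescaling. -/

section rescale
variable (g : RiemMetric n M) {Υ : M → ℝ} (hΥ : ContMDiff (𝓡 n) 𝓘(ℝ, ℝ) ∞ Υ) {x : M}

theorem ricci_rescale (v w : TangentSpace (𝓡 n) x) :
    ricci (rescale g Υ hΥ) x v w = ricci g x v w
      - ((n : ℝ) - 2) * g.inner x (leviCivita g (grad g Υ) x v) w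
      - fieldDiv g (grad g Υ) x * g.inner x v w
      + ((n : ℝ) - 2) * (g.inner x (grad g Υ x) v * g.inner x (grad g Υ x) w
        - g.inner x (grad g Υ x) (grad g Υ x) * g.inner x v w) := by
  have hr : ∀ u, riemann (rescale g Υ hΥ) x u v w = _ := fun u ↦
    curvatureField_rescale g hΥ (smoothFieldAt_extend u) (smoothFieldAt_extend v)
      (smoothFieldAt_extend w)
  simp only [extend_apply_self] at hr
  have hr' : ∀ u, riemann g x u v w = curvatureField g (extend (EuclideanSpace ℝ (Fin n)) u)
    (extend (EuclideanSpace ℝ (Fin n)) v) (extend (EuclideanSpace ℝ (Fin n)) w) x := fun u ↦ rfl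
  -- The contractions needed for the trace over `u`. The Hessian appears with coefficient `1 - n +
  -- 1`: the two outer units come from contracting against `v` and against `⟨u, w⟩`, and `n` is the
  -- trace of the identity.
  have s1 : ∑ i, g.inner x (leviCivita g (grad g Υ) x (stdVec x i)) w * stdCovec x i v =
      g.inner x (leviCivita g (grad g Υ) x v) w := by
    have := sum_mul_stdCovec ((g.inner x w).comp (leviCivita g (grad g Υ) x)) v
    simp only [ContinuousLinearMap.comp_apply] at this
    simp only [g.symm x _ w]
    exact this
  have s2 : ∀ z a, ∑ i, g.inner x (stdVec x i) z * stdCovec x i a = g.inner x a z := by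
    intro z a
    have := sum_mul_stdCovec (g.inner x z) a
    simp only [g.symm x _ z]
    exact this
  have s3 := sum_mul_stdCovec (g.inner x (grad g Υ x)) v
  have s4 := sum_mul_stdCovec (g.inner x (grad g Υ x)) (grad g Υ x)
  have s5 := trace_eq_sum_stdCovec (leviCivita g (grad g Υ) x).toLinearMap
  have s6 := sum_stdCovec_stdVec (n := n) x
  have s2a := s2 w v
  have s2b := s2 w (grad g Υ x)
  have s2c := s2 w (leviCivita g (grad g Υ) x v)
  simp only [ricci, fieldDiv, s5, hr, hr', map_add, map_sub, map_smul, smul_eq_mul,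
    ContinuousLinearMap.coe_coe]
  simp only [sub_mul, Finset.sum_add_distrib, Finset.sum_sub_distrib, ← Finset.mul_sum,
    s1, s2c, mul_assoc, s6]
  have t1 : ∑ i, g.inner x (grad g Υ x) (stdVec x i) *
      (g.inner x (grad g Υ x) w * stdCovec x i v) =
      g.inner x (grad g Υ x) w * g.inner x (grad g Υ x) v := by
    rw [← s3, Finset.mul_sum]
    exact Finset.sum_congr rfl fun i _ ↦ by ring
  have t2 : ∑ i, g.inner x (stdVec x i) w *
      (g.inner x (grad g Υ x) (grad g Υ x) * stdCovec x i v) =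
      g.inner x (grad g Υ x) (grad g Υ x) * g.inner x v w := by
    rw [← s2a, Finset.mul_sum]
    exact Finset.sum_congr rfl fun i _ ↦ by ring
  have t3 : ∑ i, g.inner x (grad g Υ x) (stdVec x i) *
      (g.inner x v w * stdCovec x i (grad g Υ x)) =
      g.inner x v w * g.inner x (grad g Υ x) (grad g Υ x) := by
    rw [← s4, Finset.mul_sum]
    exact Finset.sum_congr rfl fun i _ ↦ by ring
  rw [t1, t2, t3, s2b]
  ring

theorem metricTrace_rescale (B : TangentSpace (𝓡 n) x →ₗ[ℝ] TangentSpace (𝓡 n) x →ₗ[ℝ] ℝ) :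
    metricTrace (rescale g Υ hΥ) x (fun v w ↦ B v w) =
      Real.exp (-2 * Υ x) * metricTrace g x (fun v w ↦ B v w) := by
  simp only [metricTrace, sharp_rescale, map_smul, smul_eq_mul, Finset.mul_sum]

theorem metricTrace_self : metricTrace g x (fun v w ↦ g.inner x v w) = n := by
  simp only [metricTrace, inner_sharp_right, sum_stdCovec_stdVec]

theorem metricTrace_mul_self (a : TangentSpace (𝓡 n) x) :
    metricTrace g x (fun v w ↦ g.inner x a v * g.inner x a w) = g.inner x a a := by
  simp only [metricTrace, inner_sharp_right, sum_mul_stdCovec]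

theorem scalarCurvature_rescale :
    scalarCurvature (rescale g Υ hΥ) x = Real.exp (-2 * Υ x) * (scalarCurvature g x
      - 2 * ((n : ℝ) - 1) * fieldDiv g (grad g Υ) x
      - ((n : ℝ) - 1) * ((n : ℝ) - 2) * g.inner x (grad g Υ x) (grad g Υ x)) := by
  have h := metricTrace_rescale g hΥ (ricciHom (rescale g Υ hΥ) x)
  simp only [ricciHom_apply] at h
  refine h.trans (congrArg (Real.exp (-2 * Υ x) * ·) ?_)
  have h1 := metricTrace_inner g (leviCivita g (grad g Υ) x).toLinearMap
  have h2 := metricTrace_self g (x := x)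
  have h3 := metricTrace_mul_self g (grad g Υ x)
  simp only [metricTrace, ContinuousLinearMap.coe_coe] at h1 h2 h3
  simp only [metricTrace, scalarCurvature, ricci_rescale, fieldDiv, Finset.sum_add_distrib,
    Finset.sum_sub_distrib, ← Finset.mul_sum, h1, h2, h3]
  ring

/-- The new connection adds `n ⟨G, V⟩` to the divergence of a fixed field `V`, where `G` is the
gradient of `Υ`. Raising the index with the new metric multiplies `V` by `e^{-2Υ}`, whose derivative
contributes `-2 ⟨G, V⟩`. -/
theorem divergence_rescale {v : Form n M} (hv : IsSmoothForm v) (x : M) :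
    divergence (rescale g Υ hΥ) v x = Real.exp (-2 * Υ x) * (divergence g v x
      + ((n : ℝ) - 2) * g.inner x (grad g Υ x) (sharp g x (v x))) := by
  have hV := (smoothFieldAt_sharp g hv x).fieldDiffAt
  have hE : MDifferentiableAt (𝓡 n) 𝓘(ℝ, ℝ) (fun y ↦ Real.exp (-2 * Υ y)) x :=
    (smoothFnAt_exp_mul (hΥ x) (-2)).mdifferentiableAt
  have e : (fun y ↦ sharp (rescale g Υ hΥ) y (v y)) =
      (fun y ↦ Real.exp (-2 * Υ y)) • fun y ↦ sharp g y (v y) := by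
    ext1 y
    rw [sharp_rescale]
    rfl
  rw [divergence_eq_fieldDiv _ (smoothFieldAt_sharp _ hv x).fieldDiffAt, e,
    fieldDiv_smul _ hE hV, divergence_eq_fieldDiv g hV,
    mvfderiv_exp_mul ((hΥ x).mdifferentiableAt (by simp)), ← inner_grad g]
  have h : fieldDiv (rescale g Υ hΥ) (fun y ↦ sharp g y (v y)) x =
      fieldDiv g (fun y ↦ sharp g y (v y)) x + n * g.inner x (grad g Υ x) (sharp g x (v x)) := by
    simp only [fieldDiv, trace_eq_sum_stdCovec, ContinuousLinearMap.coe_coe,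
      leviCivita_rescale g hΥ hV, map_add, map_sub, map_smul, smul_eq_mul, Finset.sum_add_distrib,
      Finset.sum_sub_distrib, ← Finset.mul_sum, sum_mul_stdCovec, sum_stdCovec_stdVec,
      inner_sharp_right]
    rw [← inner_sharp g x (v x), g.symm]
    ring
  rw [h]
  ring

end rescale

/-- The covariant derivative of a closed 1-form is symmetric. -/
theorem leviCivita_sharp_symm (g : RiemMetric n M) {u : Form n M} (hu : IsSmoothForm u)
    (hu' : IsClosedForm u) {x : M} (v w : TangentSpace (𝓡 n) x) :
    g.inner x (leviCivita g (fun y ↦ sharp g y (u y)) x v) w =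
      g.inner x (leviCivita g (fun y ↦ sharp g y (u y)) x w) v := by
  have hU := (smoothFieldAt_sharp g hu x).fieldDiffAt
  have hv := (smoothFieldAt_extend v).fieldDiffAt
  have hw := (smoothFieldAt_extend w).fieldDiffAt
  have h := hu' _ _ x hv hw
  have h1 := leviCivita_metric_apply g hU hw v
  have h2 := leviCivita_metric_apply g hU hv w
  -- Torsion freeness rewrites the bracket in `du`, and metric compatibility expands the
  -- derivatives: `du` is the antisymmetrisation of `∇u`.
  rw [← leviCivita_sub_swap g hv hw] at h
  simp only [inner_sharp, extend_apply_self] at h h1 h2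
  rw [map_sub] at h
  linarith

/-! ### The divergence of the correction form. -/

theorem sharp_skewContraction (g : RiemMetric n M) (u v : Form n M) (Υ : M → ℝ) :
    (fun y ↦ sharp g y (skewContraction g u v Υ y)) =
      (fun _ : M ↦ (2⁻¹ : ℝ)) •
        ((fun y ↦ g.inner y (grad g Υ y) (sharp g y (u y))) • (fun y ↦ sharp g y (v y))
          - (fun y ↦ g.inner y (sharp g y (v y)) (sharp g y (u y))) • grad g Υ) := by
  ext1 y
  refine eq_of_inner_eq g fun z ↦ ?_
  rw [inner_sharp]
  simp only [skewContraction, Pi.smul_apply', Pi.sub_apply, map_smul, map_sub, smul_apply,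
    sub_apply, smul_eq_mul, inner_grad, inner_sharp]

theorem smoothFieldAt_sharp_skewContraction (g : RiemMetric n M) {u v : Form n M}
    (hu : IsSmoothForm u) (hv : IsSmoothForm v) {Υ : M → ℝ}
    (hΥ : ContMDiff (𝓡 n) 𝓘(ℝ, ℝ) ∞ Υ) (x : M) :
    SmoothFieldAt (fun y ↦ sharp g y (skewContraction g u v Υ y)) x := by
  have hU := smoothFieldAt_sharp g hu x
  have hV := smoothFieldAt_sharp g hv x
  have hG : SmoothFieldAt (grad g Υ) x := smoothFieldAt_grad g (hΥ x)
  have h : SmoothFnAt n (fun _ : M ↦ (2⁻¹ : ℝ)) x := contMDiffAt_const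
  rw [sharp_skewContraction]
  exact ((hV.smul (smoothFnAt_inner g hG hU)).sub (hG.smul (smoothFnAt_inner g hV hU))).smul h

/-- The product rule also yields `⟨G, ∇_V U⟩ - ⟨V, ∇_G U⟩`, which is zero because `u` is closed. -/
theorem divergence_skewContraction (g : RiemMetric n M) {u v : Form n M} (hu : IsSmoothForm u)
    (hv : IsSmoothForm v) (hu' : IsClosedForm u) {Υ : M → ℝ}
    (hΥ : ContMDiff (𝓡 n) 𝓘(ℝ, ℝ) ∞ Υ) (x : M) :
    divergence g (skewContraction g u v Υ) x = 2⁻¹ *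
      (g.inner x (leviCivita g (grad g Υ) x (sharp g x (v x))) (sharp g x (u x))
        + g.inner x (grad g Υ x) (sharp g x (u x)) * divergence g v x
        - g.inner x (leviCivita g (fun y ↦ sharp g y (v y)) x (grad g Υ x)) (sharp g x (u x))
        - g.inner x (sharp g x (v x)) (sharp g x (u x)) * fieldDiv g (grad g Υ) x) := by
  set U : Π y : M, TangentSpace (𝓡 n) y := fun y ↦ sharp g y (u y)
  set V : Π y : M, TangentSpace (𝓡 n) y := fun y ↦ sharp g y (v y)
  have hU : SmoothFieldAt U x := smoothFieldAt_sharp g hu x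
  have hV : SmoothFieldAt V x := smoothFieldAt_sharp g hv x
  have hG : SmoothFieldAt (grad g Υ) x := smoothFieldAt_grad g (hΥ x)
  have a := smoothFnAt_inner g hG hU
  have b := smoothFnAt_inner g hV hU
  have e : (fun y ↦ sharp g y (skewContraction g u v Υ y)) =
      (fun _ : M ↦ (2⁻¹ : ℝ)) • ((fun y ↦ g.inner y (grad g Υ y) (U y)) • V
        - (fun y ↦ g.inner y (V y) (U y)) • grad g Υ) := sharp_skewContraction g u v Υ
  have s1 := hV.smul a
  have s2 := hG.smul b
  have s3 : SmoothFnAt n (fun _ : M ↦ (2⁻¹ : ℝ)) x := contMDiffAt_const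
  have s4 := (s1.sub s2).smul s3
  rw [divergence_eq_fieldDiv g (by rw [e]; exact s4.fieldDiffAt), e,
    fieldDiv_smul g s3.mdifferentiableAt (s1.sub s2).fieldDiffAt,
    fieldDiv_sub g s1.fieldDiffAt s2.fieldDiffAt,
    fieldDiv_smul g a.mdifferentiableAt hV.fieldDiffAt,
    fieldDiv_smul g b.mdifferentiableAt hG.fieldDiffAt,
    leviCivita_metric_apply g hG.fieldDiffAt hU.fieldDiffAt,
    leviCivita_metric_apply g hV.fieldDiffAt hU.fieldDiffAt, mvfderiv_const,
    divergence_eq_fieldDiv g hV.fieldDiffAt]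
  have hs := leviCivita_sharp_symm g hu hu' (V x) (grad g Υ x)
  rw [g.symm x (grad g Υ x) (leviCivita g U x (V x)), g.symm x (V x) (leviCivita g U x _), hs]
  simp only [zero_apply]
  ring

end

section

/-! ### Dimension four -/

section dimensionFour
variable {M : Type*} [TopologicalSpace M] [ChartedSpace (EuclideanSpace ℝ (Fin 4)) M]
  [IsManifold (𝓡 4) ∞ M]

theorem schoutenTrace_eq (g : RiemMetric 4 M) (x : M) :
    schoutenTrace g x = scalarCurvature g x / 6 := by
  have h := metricTrace_self g (x := x)
  simp only [metricTrace] at h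
  simp only [schoutenTrace, metricTrace, schouten, mul_sub, Finset.sum_sub_distrib,
    ← Finset.mul_sum, h, scalarCurvature]
  norm_num
  ring

/-- The coefficient `2 / 3` collects one third from the trace part of `-4 P` and one third from `2
J`, since `J = R / 6`. -/
theorem Q1Pair_eq (g : RiemMetric 4 M) (u v : Form 4 M) (x : M) :
    Q1Pair g u v x = -mvfderiv (𝓡 4) (divergence g v) x (sharp g x (u x))
      - 2 * ricci g x (sharp g x (u x)) (sharp g x (v x))
      + 2 / 3 * scalarCurvature g x * g.inner x (sharp g x (u x)) (sharp g x (v x)) := by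
  rw [Q1Pair, Q1, schoutenTrace_eq, schouten, ← inner_sharp_right g x (v x)]
  norm_num
  ring

/-- The conformal change of `Q_1(u, v)`. -/
theorem Q1Pair_rescale (g : RiemMetric 4 M) {u v : Form 4 M} (hu : IsSmoothForm u)
    (hv : IsSmoothForm v) (hu' : IsClosedForm u) (hv' : IsClosedForm v) {Υ : M → ℝ}
    (hΥ : ContMDiff (𝓡 4) 𝓘(ℝ, ℝ) ∞ Υ) (x : M) :
    Real.exp (4 * Υ x) * Q1Pair (rescale g Υ hΥ) u v x =
      Q1Pair g u v x + 4 * divergence g (skewContraction g u v Υ) x := by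
  have hG : SmoothFieldAt (grad g Υ) x := smoothFieldAt_grad g (hΥ x)
  have hV : SmoothFieldAt (fun y ↦ sharp g y (v y)) x := smoothFieldAt_sharp g hv x
  have hδ : MDifferentiableAt (𝓡 4) 𝓘(ℝ, ℝ) (divergence g v) x := by
    have e : divergence g v = fieldDiv g (fun y ↦ sharp g y (v y)) := funext fun y ↦
      divergence_eq_fieldDiv g (smoothFieldAt_sharp g hv y).fieldDiffAt
    rw [e]
    exact (smoothFnAt_fieldDiv g hV).mdifferentiableAt
  have hGV := (smoothFnAt_inner g hG hV).mdifferentiableAt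
  have hE : MDifferentiableAt (𝓡 4) 𝓘(ℝ, ℝ) (fun y ↦ Real.exp (-2 * Υ y)) x :=
    (smoothFnAt_exp_mul (hΥ x) (-2)).mdifferentiableAt
  have hc : MDifferentiableAt (𝓡 4) 𝓘(ℝ, ℝ) (fun _ : M ↦ (2 : ℝ)) x := mdifferentiableAt_const
  have hdiv : divergence (rescale g Υ hΥ) v = (fun y ↦ Real.exp (-2 * Υ y)) *
      (divergence g v + (fun _ ↦ (2 : ℝ)) *
        fun y ↦ g.inner y (grad g Υ y) (sharp g y (v y))) := by
    ext y
    rw [divergence_rescale g hΥ hv]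
    norm_num
  have hd : mvfderiv (𝓡 4) (divergence (rescale g Υ hΥ) v) x (sharp g x (u x)) =
      Real.exp (-2 * Υ x) * (mvfderiv (𝓡 4) (divergence g v) x (sharp g x (u x)) +
        2 * (g.inner x (leviCivita g (grad g Υ) x (sharp g x (u x))) (sharp g x (v x)) +
          g.inner x (grad g Υ x) (leviCivita g (fun y ↦ sharp g y (v y)) x (sharp g x (u x))))) -
      2 * Real.exp (-2 * Υ x) * g.inner x (grad g Υ x) (sharp g x (u x)) *
        (divergence g v x + 2 * g.inner x (grad g Υ x) (sharp g x (v x))) := by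
    rw [hdiv, mvfderiv_mul hE (hδ.add (hc.mul hGV)), mvfderiv_add hδ (hc.mul hGV),
      mvfderiv_mul hc hGV, mvfderiv_const]
    simp only [add_apply, smul_apply, smul_eq_mul, mvfderiv_exp_mul
      ((hΥ x).mdifferentiableAt (by simp)), leviCivita_metric_apply g hG.fieldDiffAt
      hV.fieldDiffAt, ← inner_grad g Υ, Pi.add_apply, Pi.mul_apply, zero_apply]
    ring
  have hric : ∀ a b, ricci (rescale g Υ hΥ) x (Real.exp (-2 * Υ x) • a) (Real.exp (-2 * Υ x) • b) =
      Real.exp (-2 * Υ x) * (Real.exp (-2 * Υ x) * ricci (rescale g Υ hΥ) x a b) := by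
    intro a b
    simp only [← ricciHom_apply, map_smul, LinearMap.smul_apply, smul_eq_mul]
  -- Closedness of `v` identifies `⟨∇_G V, U⟩`, which occurs in the divergence of the correction,
  -- with `⟨∇_U V, G⟩`, which occurs in the derivative of the rescaled divergence.
  have hsymm := leviCivita_sharp_symm g hv hv' (grad g Υ x) (sharp g x (u x))
  have hH := hessian_symm g (hΥ x) (sharp g x (v x)) (sharp g x (u x))
  have hGs := g.symm x (grad g Υ x) (leviCivita g (fun y ↦ sharp g y (v y)) x (sharp g x (u x)))
  have hs := g.symm x (sharp g x (v x)) (sharp g x (u x))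
  have hE4 : Real.exp (4 * Υ x) * (Real.exp (-2 * Υ x) * Real.exp (-2 * Υ x)) = 1 := by
    rw [← Real.exp_add, ← Real.exp_add]
    ring_nf
    simp
  have hE2 : Real.exp (2 * Υ x) * Real.exp (-2 * Υ x) = 1 := by
    rw [← Real.exp_add]
    ring_nf
    simp
  rw [divergence_skewContraction g hu hv hu' hΥ, Q1Pair_eq, Q1Pair_eq, sharp_rescale,
    sharp_rescale, hric, ricci_rescale, scalarCurvature_rescale, map_smul, hd, rescale_inner,
    hsymm, hH, hs, hGs]
  simp only [map_smul, smul_apply, smul_eq_mul]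
  generalize Real.exp (-2 * Υ x) = a at *
  generalize Real.exp (2 * Υ x) = b at *
  generalize Real.exp (4 * Υ x) = c at *
  generalize mvfderiv (𝓡 4) (divergence g v) x (sharp g x (u x)) = q1
  generalize ricci g x (sharp g x (u x)) (sharp g x (v x)) = q2
  generalize scalarCurvature g x = q3
  generalize g.inner x (sharp g x (u x)) (sharp g x (v x)) = q4
  generalize g.inner x (leviCivita g (grad g Υ) x (sharp g x (u x))) (sharp g x (v x)) = q5
  generalize g.inner x (leviCivita g (fun y ↦ sharp g y (v y)) x (sharp g x (u x)))
    (grad g Υ x) = q6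
  generalize g.inner x (grad g Υ x) (sharp g x (u x)) = q7
  generalize g.inner x (grad g Υ x) (sharp g x (v x)) = q8
  generalize g.inner x (grad g Υ x) (grad g Υ x) = q9
  generalize fieldDiv g (grad g Υ) x = q10
  generalize divergence g v x = q11
  push_cast
  -- The coefficient of `hE4` is the right-hand side of the goal. The other one is the scalar
  -- curvature term, the only place where the rescaled inner product brings in `e^{2Υ}`.
  linear_combination (-q1 - 2 * q2 + 2 / 3 * q3 * q4 + 2 * q7 * q11 + 2 * q5 - 2 * q6
    - 2 * q10 * q4) * hE4 + c * a * a * q4 * (2 / 3) * (q3 - 6 * q10 - 6 * q9) * hE2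

end dimensionFour

end

section

/-! ### The transformation law for densities. -/

section density
variable {M : Type*} [TopologicalSpace M] [ChartedSpace (EuclideanSpace ℝ (Fin 4)) M]
  [IsManifold (𝓡 4) ∞ M]

theorem gram_rescale {n : ℕ} {M : Type*} [TopologicalSpace M]
    [ChartedSpace (EuclideanSpace ℝ (Fin n)) M] [IsManifold (𝓡 n) ∞ M] (g : RiemMetric n M)
    {Υ : M → ℝ} (hΥ : ContMDiff (𝓡 n) 𝓘(ℝ, ℝ) ∞ Υ) (x : M) (e : Fin n → TangentSpace (𝓡 n) x) :
    gram (rescale g Υ hΥ) x e = Real.exp (2 * Υ x) • gram g x e := by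
  ext i j
  simp [gram, rescale_inner]

theorem Q1Density_rescale (g : RiemMetric 4 M) {u v : Form 4 M} (hu : IsSmoothForm u)
    (hv : IsSmoothForm v) (hu' : IsClosedForm u) (hv' : IsClosedForm v) {Υ : M → ℝ}
    (hΥ : ContMDiff (𝓡 4) 𝓘(ℝ, ℝ) ∞ Υ) (x : M) :
    Q1Density (rescale g Υ hΥ) u v x = Q1Density g u v x
      + (4 : ℝ) • inScale g (-4) (divergence g (skewContraction g u v Υ)) x := by
  refine Subtype.ext (funext fun b ↦ ?_)
  have h := Q1Pair_rescale g hu hv hu' hv' hΥ x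
  change (gram (rescale g Υ hΥ) x b).det ^ (-(-4 : ℝ) / (2 * (4 : ℕ))) *
      Q1Pair (rescale g Υ hΥ) u v x =
    (gram g x b).det ^ (-(-4 : ℝ) / (2 * (4 : ℕ))) * Q1Pair g u v x +
      4 * ((gram g x b).det ^ (-(-4 : ℝ) / (2 * (4 : ℕ))) *
        divergence g (skewContraction g u v Υ) x)
  -- The Gram determinant of a fixed frame scales by `(e^{2Υ})^4`, and weight `-4` takes its square
  -- root. This is the factor in `Q1Pair_rescale`.
  have e : (Real.exp (2 * Υ x) ^ 4) ^ (-(-4 : ℝ) / (2 * (4 : ℕ))) = Real.exp (4 * Υ x) := by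
    rw [← Real.exp_nat_mul, ← Real.exp_mul]
    congr 1
    push_cast
    ring
  rw [gram_rescale, Matrix.det_smul, Fintype.card_fin,
    Real.mul_rpow (by positivity) (gram_det_nonneg g x b), e]
  linear_combination (gram g x b).det ^ (-(-4 : ℝ) / (2 * (4 : ℕ))) * h

end density

/-! ### Smoothness of the curvature and continuity of the pairing. -/

section smoothness
variable {n : ℕ} {M : Type*} [TopologicalSpace M] [ChartedSpace (EuclideanSpace ℝ (Fin n)) M]
  [IsManifold (𝓡 n) ∞ M]

theorem smoothFieldAt_curvatureField (g : RiemMetric n M) {x : M}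
    {X Y Z : Π y : M, TangentSpace (𝓡 n) y} (hX : SmoothFieldAt X x) (hY : SmoothFieldAt Y x)
    (hZ : SmoothFieldAt Z x) : SmoothFieldAt (curvatureField g X Y Z) x :=
  ((smoothFieldAt_leviCivita g hX (smoothFieldAt_leviCivita g hY hZ)).sub
    (smoothFieldAt_leviCivita g hY (smoothFieldAt_leviCivita g hX hZ))).sub
    (smoothFieldAt_leviCivita g (smoothFieldAt_mlieBracket hX hY) hZ)

theorem eventually_smoothFieldAt_coordFrame {x₀ x : M}
    (hx : x ∈ (chartAt (EuclideanSpace ℝ (Fin n)) x₀).source) (i : Fin n) :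
    ∀ᶠ y in nhds x, SmoothFieldAt (coordFrame x₀ i) y :=
  (eventually_mem_chart_source hx).mono fun _ hy ↦ smoothFieldAt_coordFrame x₀ hy i

/-- The trace is taken in a fixed coordinate frame. Smoothness of `Y` and `Z` at all nearby points
is assumed because `riemann_eq_curvatureField` is used at each of them. -/
theorem smoothFnAt_ricci (g : RiemMetric n M) {x : M} {Y Z : Π y : M, TangentSpace (𝓡 n) y}
    (hY : ∀ᶠ y in nhds x, SmoothFieldAt Y y) (hZ : ∀ᶠ y in nhds x, SmoothFieldAt Z y) :
    SmoothFnAt n (fun y ↦ ricci g y (Y y) (Z y)) x := by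
  have hx := mem_chart_source (EuclideanSpace ℝ (Fin n)) x
  have h : SmoothFnAt n
      (fun y ↦ ∑ i, coordCoeff x (curvatureField g (coordFrame x i) Y Z) i y) x := by
    refine SmoothFnAt.sum fun i _ ↦ ?_
    exact (smoothFieldAt_iff_coordCoeff x _ hx).1 (smoothFieldAt_curvatureField g
      (smoothFieldAt_coordFrame x hx i) hY.self_of_nhds hZ.self_of_nhds) i
  refine ContMDiffAt.congr_of_eventuallyEq h ?_
  filter_upwards [eventually_mem_chart_source hx, hY, hZ] with y hy hYy hZy
  rw [ricci_eq_trace, trace_eq_sum_repr _ (coordBasis x hy)]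
  refine Finset.sum_congr rfl fun i _ ↦ ?_
  rw [coordCoeff_eq _ _ _ hy, ← coordFrame_eq x hy,
    ← riemann_eq_curvatureField g (smoothFieldAt_coordFrame x hy i) hYy hZy]
  rfl

/-- The Ricci tensor as an endomorphism of the tangent space. -/
def ricciEnd (g : RiemMetric n M) (x : M) : TangentSpace (𝓡 n) x →ₗ[ℝ] TangentSpace (𝓡 n) x :=
  (flat g x).symm.toLinearMap ∘ₗ
    (LinearMap.toContinuousLinearMap (𝕜 := ℝ) (E := TangentSpace (𝓡 n) x) (F' := ℝ)).toLinearMap ∘ₗ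
      ricciHom g x

theorem inner_ricciEnd (g : RiemMetric n M) (x : M) (v w : TangentSpace (𝓡 n) x) :
    g.inner x (ricciEnd g x v) w = ricci g x v w :=
  inner_sharp g x (LinearMap.toContinuousLinearMap (ricciHom g x v)) w

theorem scalarCurvature_eq_trace (g : RiemMetric n M) (x : M) :
    scalarCurvature g x = LinearMap.trace ℝ (TangentSpace (𝓡 n) x) (ricciEnd g x) := by
  rw [← metricTrace_inner, scalarCurvature]
  exact congrArg _ (funext₂ fun v w ↦ (inner_ricciEnd g x v w).symm)

theorem smoothFnAt_scalarCurvature (g : RiemMetric n M) (x : M) :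
    SmoothFnAt n (scalarCurvature g) x := by
  have hx := mem_chart_source (EuclideanSpace ℝ (Fin n)) x
  have h : SmoothFnAt n
      (fun y ↦ ∑ i, coordCoeff x (fun y ↦ ricciEnd g y (coordFrame x i y)) i y) x := by
    refine SmoothFnAt.sum fun i _ ↦ ?_
    refine (smoothFieldAt_iff_coordCoeff x _ hx).1 (smoothFieldAt_of_inner g hx fun j ↦ ?_) i
    have e : (fun z ↦ g.inner z (coordFrame x j z) (ricciEnd g z (coordFrame x i z))) =
        fun z ↦ ricci g z (coordFrame x i z) (coordFrame x j z) := by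
      ext z
      rw [g.symm, inner_ricciEnd]
    rw [e]
    exact smoothFnAt_ricci g (eventually_smoothFieldAt_coordFrame hx i)
      (eventually_smoothFieldAt_coordFrame hx j)
  refine ContMDiffAt.congr_of_eventuallyEq h ?_
  filter_upwards [eventually_mem_chart_source hx] with y hy
  rw [scalarCurvature_eq_trace, trace_eq_sum_repr _ (coordBasis x hy)]
  refine Finset.sum_congr rfl fun i _ ↦ ?_
  rw [coordCoeff_eq _ _ _ hy, coordFrame_eq x hy]

theorem smoothFnAt_divergence (g : RiemMetric n M) {v : Form n M} (hv : IsSmoothForm v) (x : M) :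
    SmoothFnAt n (divergence g v) x := by
  have e : divergence g v = fieldDiv g (fun y ↦ sharp g y (v y)) := funext fun y ↦
    divergence_eq_fieldDiv g (smoothFieldAt_sharp g hv y).fieldDiffAt
  rw [e]
  exact smoothFnAt_fieldDiv g (smoothFieldAt_sharp g hv x)

theorem continuous_Q1Pair {M : Type*} [TopologicalSpace M]
    [ChartedSpace (EuclideanSpace ℝ (Fin 4)) M] [IsManifold (𝓡 4) ∞ M] (g : RiemMetric 4 M)
    {u v : Form 4 M} (hu : IsSmoothForm u) (hv : IsSmoothForm v) :
    Continuous (Q1Pair g u v) := by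
  have e : Q1Pair g u v = _ := funext (Q1Pair_eq g u v)
  rw [e, continuous_iff_continuousAt]
  intro x
  have hU := smoothFieldAt_sharp g hu
  have hV := smoothFieldAt_sharp g hv
  have h1 := smoothFnAt_mvfderiv (smoothFnAt_divergence g hv x) (hU x)
  have h2 := smoothFnAt_ricci g (Filter.Eventually.of_forall (f := nhds x) hU)
    (Filter.Eventually.of_forall hV)
  have h3 := smoothFnAt_inner g (hU x) (hV x)
  have h4 := smoothFnAt_scalarCurvature g x
  exact (((h1.neg).sub (contMDiffAt_const.mul h2)).add
    ((contMDiffAt_const.mul h4).mul h3)).continuousAt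

end smoothness

end

section

/-! ### The divergence in coordinates -/

/-- Jacobi's formula for the derivative of a determinant. -/
theorem fderiv_det {E : Type*} [NormedAddCommGroup E] [NormedSpace ℝ E] {n : ℕ}
    {A : E → Matrix (Fin n) (Fin n) ℝ} {x : E} (h : ∀ i j, DifferentiableAt ℝ (fun y ↦ A y i j) x)
    (v : E) :
    fderiv ℝ (fun y ↦ (A y).det) x v =
      ((Matrix.of fun i j ↦ fderiv ℝ (fun y ↦ A y i j) x v) * (A x).adjugate).trace := by
  -- As a multilinear function of its rows, the determinant has as derivative the sum over rows of
  -- determinants with that row differentiated. Cramer's rule turns each of these into a diagonal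
  -- entry of the product with the adjugate.
  let F : ContinuousMultilinearMap ℝ (fun _ : Fin n ↦ Fin n → ℝ) ℝ :=
    { toMultilinearMap := (Matrix.detRowAlternating (n := Fin n) (R := ℝ)).toMultilinearMap
      cont := by
        change Continuous fun A : Fin n → Fin n → ℝ ↦ (Matrix.of A).det
        exact Continuous.matrix_det continuous_id }
  have hA : HasFDerivAt (fun y ↦ (fun i j ↦ A y i j : Fin n → Fin n → ℝ))
      (ContinuousLinearMap.pi fun i ↦ ContinuousLinearMap.pi fun j ↦
        fderiv ℝ (fun y ↦ A y i j) x) x :=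
    hasFDerivAt_pi.2 fun i ↦ hasFDerivAt_pi.2 fun j ↦ (h i j).hasFDerivAt
  have hF : HasFDerivAt (fun y ↦ (A y).det) _ x := (F.hasFDerivAt _).comp x hA
  rw [hF.fderiv, ContinuousLinearMap.comp_apply]
  refine (ContinuousMultilinearMap.linearDeriv_apply F _ _).trans ?_
  rw [Matrix.trace]
  refine Finset.sum_congr rfl fun i _ ↦ ?_
  change ((A x).updateRow i fun j ↦ fderiv ℝ (fun y ↦ A y i j) x v).det = _
  rw [← Matrix.cramer_transpose_apply, Matrix.cramer_eq_adjugate_mulVec, Matrix.diag_apply,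
    Matrix.mul_apply, ← Matrix.adjugate_transpose]
  simp only [Matrix.mulVec, dotProduct, Matrix.transpose_apply, Matrix.of_apply, mul_comm]

variable {n : ℕ} {M : Type*} [TopologicalSpace M] [ChartedSpace (EuclideanSpace ℝ (Fin n)) M]
  [IsManifold (𝓡 n) ∞ M]

/-- Let `A` be the Gram matrix and `a` the matrix of `v ↦ ∇_v e_i`. Then `∂_i A = aᵀ A + A a`, and
Jacobi's formula gives `2 det A tr a`. -/
theorem mvfderiv_det_coordGram (g : RiemMetric n M) {x₀ x : M}
    (hx : x ∈ (chartAt (EuclideanSpace ℝ (Fin n)) x₀).source) (i : Fin n) :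
    mvfderiv (𝓡 n) (fun y ↦ (coordGram g x₀ y).det) x (coordFrame x₀ i x) =
      2 * (coordGram g x₀ x).det * fieldDiv g (coordFrame x₀ i) x := by
  have hx' : x ∈ (extChartAt (𝓡 n) x₀).source := by simpa using hx
  have hG := fun j k ↦ contMDiffAt_coordGram g hx j k
  have he := fun j ↦ (smoothFieldAt_coordFrame x₀ hx j).fieldDiffAt
  have hd : SmoothFnAt n (fun y ↦ (coordGram g x₀ y).det) x := SmoothFnAt.det hG
  rw [mvfderiv_coordFrame hx hd.mdifferentiableAt]
  have h1 := fderiv_det (A := fun y ↦ coordGram g x₀ ((extChartAt (𝓡 n) x₀).symm y))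
    (fun j k ↦ (contDiffAt_comp_extChartAt_symm hx (hG j k)).differentiableAt (by simp))
    (EuclideanSpace.single i (1 : ℝ))
  refine Eq.trans h1 ?_
  rw [(extChartAt (𝓡 n) x₀).left_inv hx']
  set a : Matrix (Fin n) (Fin n) ℝ := LinearMap.toMatrix (coordBasis x₀ hx) (coordBasis x₀ hx)
    (leviCivita g (coordFrame x₀ i) x).toLinearMap with ha
  have hL : ∀ j k, g.inner x (leviCivita g (coordFrame x₀ j) x (coordFrame x₀ i x))
      (coordFrame x₀ k x) = (a.transpose * coordGram g x₀ x) j k := by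
    intro j k
    -- Metric compatibility involves `∇_{e_i} e_j`, whereas `a` records `∇_{e_j} e_i`. They agree,
    -- as coordinate fields commute.
    have h3 := leviCivita_sub_swap g (he i) (he j)
    rw [mlieBracket_coordFrame hx, sub_eq_zero] at h3
    have h4 : leviCivita g (coordFrame x₀ i) x (coordFrame x₀ j x) =
        ∑ l, a l j • coordFrame x₀ l x := by
      conv_lhs => rw [← (coordBasis x₀ hx).sum_repr
        (leviCivita g (coordFrame x₀ i) x (coordFrame x₀ j x))]
      refine Finset.sum_congr rfl fun l _ ↦ ?_
      rw [ha, LinearMap.toMatrix_apply, coordFrame_eq x₀ hx j, coordFrame_eq x₀ hx l]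
      rfl
    rw [h3, h4]
    simp only [map_sum, map_smul, sum_apply, smul_apply, smul_eq_mul, Matrix.mul_apply,
      Matrix.transpose_apply, coordGram, gram, Matrix.of_apply]
  have hsym : (coordGram g x₀ x).transpose = coordGram g x₀ x := by
    ext j k
    exact g.symm x _ _
  have hB : (Matrix.of fun j k ↦ fderiv ℝ (fun y ↦ coordGram g x₀ ((extChartAt (𝓡 n) x₀).symm y) j k)
      (extChartAt (𝓡 n) x₀ x) (EuclideanSpace.single i (1 : ℝ))) =
      a.transpose * coordGram g x₀ x + coordGram g x₀ x * a := by
    ext j k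
    have h5 := mvfderiv_coordFrame hx (hG j k).mdifferentiableAt i
    rw [Matrix.of_apply]
    refine h5.symm.trans ?_
    have h6 := leviCivita_metric_apply g (he j) (he k) (coordFrame x₀ i x)
    refine h6.trans ?_
    have h7 : (a.transpose * coordGram g x₀ x) k j = (coordGram g x₀ x * a) j k := by
      conv_rhs => rw [← hsym, ← a.transpose_transpose, ← Matrix.transpose_mul,
        Matrix.transpose_apply]
    rw [hL, g.symm, hL, Matrix.add_apply, h7]
  have htr : fieldDiv g (coordFrame x₀ i) x = a.trace := by
    rw [fieldDiv, LinearMap.trace_eq_matrix_trace ℝ (coordBasis x₀ hx)]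
  rw [hB, htr, add_mul, Matrix.trace_add, mul_assoc, Matrix.mul_adjugate, Matrix.trace_mul_comm
    (coordGram g x₀ x * a), ← mul_assoc, Matrix.adjugate_mul]
  simp only [Matrix.mul_smul, Matrix.smul_mul, mul_one, one_mul, Matrix.trace_smul,
    Matrix.trace_transpose, smul_eq_mul]
  ring

/-- The volume density `√(det g_{ij})` of the chart at `x₀`. -/
def coordDensity (g : RiemMetric n M) (x₀ x : M) : ℝ := Real.sqrt (coordGram g x₀ x).det

theorem coordDensity_nonneg (g : RiemMetric n M) (x₀ x : M) : 0 ≤ coordDensity g x₀ x :=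
  Real.sqrt_nonneg _

theorem coordDensity_rescale (g : RiemMetric n M) {Υ : M → ℝ}
    (hΥ : ContMDiff (𝓡 n) 𝓘(ℝ, ℝ) ∞ Υ) (x₀ x : M) :
    coordDensity (rescale g Υ hΥ) x₀ x = coordDensity g x₀ x * Real.exp (n * Υ x) := by
  rw [coordDensity, coordDensity, coordGram, coordGram, gram_rescale, Matrix.det_smul,
    Fintype.card_fin, ← Real.exp_nat_mul, mul_comm, Real.sqrt_mul' _ (Real.exp_pos _).le,
    show (n : ℝ) * (2 * Υ x) = n * Υ x + n * Υ x by ring, Real.exp_add,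
    Real.sqrt_mul_self (Real.exp_pos _).le]

theorem coordDensity_pos (g : RiemMetric n M) {x₀ x : M}
    (hx : x ∈ (chartAt (EuclideanSpace ℝ (Fin n)) x₀).source) : 0 < coordDensity g x₀ x :=
  Real.sqrt_pos.2 (coordGram_det_pos g hx)

theorem smoothFnAt_coordDensity (g : RiemMetric n M) {x₀ x : M}
    (hx : x ∈ (chartAt (EuclideanSpace ℝ (Fin n)) x₀).source) :
    SmoothFnAt n (coordDensity g x₀) x := by
  have hd : SmoothFnAt n (fun y ↦ (coordGram g x₀ y).det) x :=
    SmoothFnAt.det fun j k ↦ contMDiffAt_coordGram g hx j k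
  exact (Real.contDiffAt_sqrt (coordGram_det_pos g hx).ne').contMDiffAt.comp x hd

theorem mvfderiv_coordDensity (g : RiemMetric n M) {x₀ x : M}
    (hx : x ∈ (chartAt (EuclideanSpace ℝ (Fin n)) x₀).source) (i : Fin n) :
    mvfderiv (𝓡 n) (coordDensity g x₀) x (coordFrame x₀ i x) =
      coordDensity g x₀ x * fieldDiv g (coordFrame x₀ i) x := by
  have hD := (smoothFnAt_coordDensity g hx).mdifferentiableAt
  -- Differentiating the square and cancelling the positive density gives the derivative of the
  -- root.
  have hsq : (fun y ↦ (coordGram g x₀ y).det) =ᶠ[nhds x] coordDensity g x₀ * coordDensity g x₀ := by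
    filter_upwards [eventually_mem_chart_source hx] with y hy
    exact (Real.mul_self_sqrt (coordGram_det_pos g hy).le).symm
  have h1 := mvfderiv_det_coordGram g hx i
  have h2 : mvfderiv (𝓡 n) (fun y ↦ (coordGram g x₀ y).det) x (coordFrame x₀ i x) =
      mvfderiv (𝓡 n) (coordDensity g x₀ * coordDensity g x₀) x (coordFrame x₀ i x) :=
    congrArg (fun A : EuclideanSpace ℝ (Fin n) →L[ℝ] ℝ ↦ A (coordFrame x₀ i x)) hsq.mfderiv_eq
  have h0 : (coordGram g x₀ x).det = coordDensity g x₀ x * coordDensity g x₀ x := hsq.self_of_nhds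
  rw [h2, mvfderiv_mul hD hD, h0] at h1
  simp only [add_apply, smul_apply, smul_eq_mul] at h1
  have h3 : coordDensity g x₀ x * (mvfderiv (𝓡 n) (coordDensity g x₀) x (coordFrame x₀ i x)) =
      coordDensity g x₀ x * (coordDensity g x₀ x * fieldDiv g (coordFrame x₀ i) x) := by
    linarith
  exact mul_left_cancel₀ (coordDensity_pos g hx).ne' h3

theorem fieldDiv_sum (g : RiemMetric n M) {ι : Type*} (s : Finset ι)
    {X : ι → Π y : M, TangentSpace (𝓡 n) y} {x : M} (hX : ∀ i, SmoothFieldAt (X i) x) :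
    SmoothFieldAt (∑ i ∈ s, X i) x ∧ fieldDiv g (∑ i ∈ s, X i) x = ∑ i ∈ s, fieldDiv g (X i) x := by
  classical
  induction s using Finset.induction_on with
  | empty =>
    have h0 : SmoothFieldAt (0 : Π y : M, TangentSpace (𝓡 n) y) x :=
      (contMDiff_zeroSection ℝ (TangentSpace (𝓡 n) : M → Type _)) x
    refine ⟨by simpa using h0, ?_⟩
    have h1 := fieldDiv_sub g h0.fieldDiffAt h0.fieldDiffAt
    simpa using h1
  | insert a s ha ih =>
    rw [Finset.sum_insert ha, Finset.sum_insert ha, ← ih.2]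
    exact ⟨(hX a).add ih.1, fieldDiv_add g (hX a).fieldDiffAt ih.1.fieldDiffAt⟩

/-- The coordinate expression of the divergence. -/
theorem coordDensity_mul_fieldDiv (g : RiemMetric n M) {x₀ x : M}
    (hx : x ∈ (chartAt (EuclideanSpace ℝ (Fin n)) x₀).source)
    {X : Π y : M, TangentSpace (𝓡 n) y} (hX : SmoothFieldAt X x) :
    coordDensity g x₀ x * fieldDiv g X x = ∑ i, mvfderiv (𝓡 n)
      (coordDensity g x₀ * coordCoeff x₀ X i) x (coordFrame x₀ i x) := by
  have hc := (smoothFieldAt_iff_coordCoeff x₀ X hx).1 hX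
  have he := smoothFieldAt_coordFrame x₀ hx
  have hce : ∀ i, SmoothFieldAt (coordCoeff x₀ X i • coordFrame x₀ i) x := fun i ↦
    (he i).smul (hc i)
  obtain ⟨h1, h2⟩ := fieldDiv_sum g Finset.univ hce
  have hloc : ∀ᶠ y in nhds x, X y = (∑ i, coordCoeff x₀ X i • coordFrame x₀ i) y := by
    filter_upwards [eventually_mem_chart_source hx] with y hy
    rw [eq_sum_coordCoeff x₀ X hy, Finset.sum_apply]
    rfl
  rw [fieldDiv_congr g h1.fieldDiffAt hloc, h2, Finset.mul_sum]
  refine Finset.sum_congr rfl fun i _ ↦ ?_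
  rw [fieldDiv_smul g (hc i).mdifferentiableAt (he i).fieldDiffAt,
    mvfderiv_mul (smoothFnAt_coordDensity g hx).mdifferentiableAt (hc i).mdifferentiableAt]
  simp only [add_apply, smul_apply, smul_eq_mul, mvfderiv_coordDensity g hx]
  ring

end

section

/-! ### The Riemannian measure -/

variable {n : ℕ} {M : Type*} [TopologicalSpace M] [ChartedSpace (EuclideanSpace ℝ (Fin n)) M]
  [IsManifold (𝓡 n) ∞ M]

theorem mem_chart_source_of_mem_target {x : M} {y : EuclideanSpace ℝ (Fin n)}
    (hy : y ∈ (extChartAt (𝓡 n) x).target) :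
    (extChartAt (𝓡 n) x).symm y ∈ (chartAt (EuclideanSpace ℝ (Fin n)) x).source := by
  simpa using (extChartAt (𝓡 n) x).map_target hy

theorem sqrt_det_gram_coordVec (g : RiemMetric n M) {x : M} {y : EuclideanSpace ℝ (Fin n)}
    (hy : y ∈ (extChartAt (𝓡 n) x).target) :
    Real.sqrt (gram g ((extChartAt (𝓡 n) x).symm y) (coordVec x y)).det =
      coordDensity g x ((extChartAt (𝓡 n) x).symm y) := by
  have h : coordVec x y = fun i ↦ coordFrame x i ((extChartAt (𝓡 n) x).symm y) := by
    funext i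
    rw [coordFrame_eq_mfderiv x (mem_chart_source_of_mem_target hy), coordVec,
      (extChartAt (𝓡 n) x).right_inv hy]
  rw [h]
  rfl

theorem coordBasis_repr (x₀ : M) {y : M}
    (hy : y ∈ (chartAt (EuclideanSpace ℝ (Fin n)) x₀).source) (v : TangentSpace (𝓡 n) y)
    (j : Fin n) :
    (coordBasis x₀ hy).repr v j =
      (EuclideanSpace.proj j : EuclideanSpace ℝ (Fin n) →L[ℝ] ℝ)
        (mfderiv (𝓡 n) 𝓘(ℝ, EuclideanSpace ℝ (Fin n)) (extChartAt (𝓡 n) x₀) y v) := by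
  let L : TangentSpace (𝓡 n) y →ₗ[ℝ] EuclideanSpace ℝ (Fin n) :=
    (mfderiv (𝓡 n) 𝓘(ℝ, EuclideanSpace ℝ (Fin n)) (extChartAt (𝓡 n) x₀) y).toLinearMap
  have h : (coordBasis x₀ hy).coord j =
      (EuclideanSpace.proj j : EuclideanSpace ℝ (Fin n) →L[ℝ] ℝ).toLinearMap ∘ₗ L := by
    refine (coordBasis x₀ hy).ext fun i ↦ ?_
    have e : L (coordBasis x₀ hy i) = (EuclideanSpace.single i (1 : ℝ) : EuclideanSpace ℝ (Fin n)) := by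
      rw [← coordFrame_eq x₀ hy i]
      exact mfderiv_extChartAt_coordFrame x₀ hy i
    rw [LinearMap.comp_apply, e, Module.Basis.coord_apply, Module.Basis.repr_self]
    simp [Finsupp.single_apply, eq_comm]
  exact congrArg (fun A : TangentSpace (𝓡 n) y →ₗ[ℝ] ℝ ↦ A v) h

/-- The transition map between two charts is differentiable, and the volume densities transform by
the absolute value of its Jacobian determinant. -/
theorem exists_hasFDerivAt_transition (g : RiemMetric n M) {x x' : M}
    {y : EuclideanSpace ℝ (Fin n)} (hy : y ∈ (extChartAt (𝓡 n) x).target)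
    (hy' : (extChartAt (𝓡 n) x).symm y ∈ (chartAt (EuclideanSpace ℝ (Fin n)) x').source) :
    HasFDerivAt (extChartAt (𝓡 n) x' ∘ (extChartAt (𝓡 n) x).symm)
      (fderiv ℝ (extChartAt (𝓡 n) x' ∘ (extChartAt (𝓡 n) x).symm) y) y ∧
    |(fderiv ℝ (extChartAt (𝓡 n) x' ∘ (extChartAt (𝓡 n) x).symm) y).det| *
        coordDensity g x' ((extChartAt (𝓡 n) x).symm y) =
      coordDensity g x ((extChartAt (𝓡 n) x).symm y) := by
  have hp := mem_chart_source_of_mem_target hy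
  have h1 : MDifferentiableAt 𝓘(ℝ, EuclideanSpace ℝ (Fin n)) (𝓡 n) (extChartAt (𝓡 n) x).symm y := by
    have := mdifferentiableWithinAt_extChartAt_symm (I := 𝓡 n) hy
    simpa only [modelWithCornersSelf_coe, Set.range_id, mdifferentiableWithinAt_univ] using this
  have h2 : MDifferentiableAt (𝓡 n) 𝓘(ℝ, EuclideanSpace ℝ (Fin n)) (extChartAt (𝓡 n) x')
      ((extChartAt (𝓡 n) x).symm y) := mdifferentiableAt_extChartAt hy'
  have h3 := mfderiv_comp y h2 h1
  have hd := (h2.comp y h1).differentiableAt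
  refine ⟨hd.hasFDerivAt, ?_⟩
  set T := fderiv ℝ (extChartAt (𝓡 n) x' ∘ (extChartAt (𝓡 n) x).symm) y with hT
  -- The Jacobian matrix of the transition map is the change of basis between the two coordinate
  -- frames, so `gram_eq` relates the Gram determinants by its square.
  have hdet : T.det = ((coordBasis x' hy').toMatrix (coordBasis x hp)).det := by
    change LinearMap.det T.toLinearMap = _
    rw [← LinearMap.det_toMatrix (EuclideanSpace.basisFun (Fin n) ℝ).toBasis]
    congr 1
    ext j i
    rw [LinearMap.toMatrix_apply, Module.Basis.toMatrix_apply, coordBasis_repr,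
      ← coordFrame_eq x hp i, coordFrame_eq_mfderiv x hp, (extChartAt (𝓡 n) x).right_inv hy,
      OrthonormalBasis.coe_toBasis_repr_apply, EuclideanSpace.basisFun_repr,
      OrthonormalBasis.coe_toBasis, EuclideanSpace.basisFun_apply]
    rw [← mfderiv_eq_fderiv, h3] at hT
    rw [hT]
    rfl
  rw [coordDensity, coordDensity, coordGram_eq g hy', coordGram_eq g hp,
    gram_eq g _ (coordBasis x' hy') (coordBasis x hp), Matrix.det_mul, Matrix.det_mul,
    Matrix.det_transpose, mul_right_comm, ← sq, Real.sqrt_mul (sq_nonneg _), Real.sqrt_sq_eq_abs,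
    hdet]

theorem continuousOn_coordDensity_symm (g : RiemMetric n M) (x : M) :
    ContinuousOn (fun y ↦ coordDensity g x ((extChartAt (𝓡 n) x).symm y))
      (extChartAt (𝓡 n) x).target := by
  intro y hy
  have h := (smoothFnAt_coordDensity g (mem_chart_source_of_mem_target hy)).continuousAt
  exact ContinuousAt.comp_continuousWithinAt (g := coordDensity g x) h
    (continuousOn_extChartAt_symm x y hy)

/-! ### Chart measures and their agreement on overlaps. -/

variable [MeasurableSpace M] [BorelSpace M]

theorem aemeasurable_extChartAt_symm (x : M) :
    AEMeasurable (extChartAt (𝓡 n) x).symm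
      ((volume : Measure (EuclideanSpace ℝ (Fin n))).restrict (extChartAt (𝓡 n) x).target) :=
  (continuousOn_extChartAt_symm x).aemeasurable (isOpen_extChartAt_target x).measurableSet

theorem aemeasurable_coordDensity_symm (g : RiemMetric n M) (x : M) :
    AEMeasurable (fun y ↦ coordDensity g x ((extChartAt (𝓡 n) x).symm y))
      ((volume : Measure (EuclideanSpace ℝ (Fin n))).restrict (extChartAt (𝓡 n) x).target) :=
  (continuousOn_coordDensity_symm g x).aemeasurable (isOpen_extChartAt_target x).measurableSet

theorem chartVolume_eq (g : RiemMetric n M) (x : M) :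
    chartVolume g x = (((volume : Measure (EuclideanSpace ℝ (Fin n))).restrict
      (extChartAt (𝓡 n) x).target).withDensity fun y ↦ ENNReal.ofReal
        (coordDensity g x ((extChartAt (𝓡 n) x).symm y))).map (extChartAt (𝓡 n) x).symm := by
  rw [chartVolume]
  congr 1
  refine withDensity_congr_ae ?_
  filter_upwards [ae_restrict_mem (isOpen_extChartAt_target x).measurableSet] with y hy
  rw [sqrt_det_gram_coordVec g hy]

theorem chartVolume_apply (g : RiemMetric n M) (x : M) {A : Set M} (hA : MeasurableSet A) :
    chartVolume g x A =
      ∫⁻ y in (extChartAt (𝓡 n) x).target ∩ (extChartAt (𝓡 n) x).symm ⁻¹' A,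
        ENNReal.ofReal (coordDensity g x ((extChartAt (𝓡 n) x).symm y)) := by
  rw [chartVolume_eq, Measure.map_apply_of_aemeasurable
    ((aemeasurable_extChartAt_symm x).mono_ac (withDensity_absolutelyContinuous _ _)) hA,
    withDensity_apply', Measure.restrict_restrict' (isOpen_extChartAt_target x).measurableSet,
    Set.inter_comm]

theorem chartVolume_compl_source (g : RiemMetric n M) (x : M) :
    chartVolume g x (chartAt (EuclideanSpace ℝ (Fin n)) x).sourceᶜ = 0 := by
  rw [chartVolume_apply g x (chartAt _ x).open_source.measurableSet.compl]
  have : (extChartAt (𝓡 n) x).target ∩ (extChartAt (𝓡 n) x).symm ⁻¹'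
      (chartAt (EuclideanSpace ℝ (Fin n)) x).sourceᶜ = ∅ := by
    ext y
    simp only [Set.mem_inter_iff, Set.mem_preimage, Set.mem_compl_iff, Set.mem_empty_iff_false,
      iff_false, not_and, not_not]
    exact fun hy ↦ mem_chart_source_of_mem_target hy
  rw [this]
  simp

theorem chartVolume_inter_source (g : RiemMetric n M) (x : M) (A : Set M) :
    chartVolume g x (A ∩ (chartAt (EuclideanSpace ℝ (Fin n)) x).source) = chartVolume g x A := by
  have h : chartVolume g x (A \ (chartAt (EuclideanSpace ℝ (Fin n)) x).source) = 0 :=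
    measure_mono_null (fun _ h ↦ h.2) (chartVolume_compl_source g x)
  conv_rhs => rw [← measure_inter_add_sdiff A (chartAt (EuclideanSpace ℝ (Fin n))
    x).open_source.measurableSet, h, add_zero]

/-- The inverse chart is known to be continuous only on its target, so the preimage is formed in the
subtype and mapped back. -/
theorem measurableSet_target_inter_preimage (x : M) {A : Set M} (hA : MeasurableSet A) :
    MeasurableSet ((extChartAt (𝓡 n) x).target ∩ (extChartAt (𝓡 n) x).symm ⁻¹' A) := by
  have hm : Measurable ((extChartAt (𝓡 n) x).target.domRestrict (extChartAt (𝓡 n) x).symm) :=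
    (continuousOn_iff_continuous_domRestrict.1 (continuousOn_extChartAt_symm x)).measurable
  have := (MeasurableEmbedding.subtype_coe
    (isOpen_extChartAt_target (I := 𝓡 n) x).measurableSet).measurableSet_image.2 (hm hA)
  rwa [Set.domRestrict_eq, Set.preimage_comp, Subtype.image_preimage_coe] at this

/-- The measures defined by two charts agree on the intersection of their domains. -/
theorem chartVolume_eq_chartVolume (g : RiemMetric n M) (x x' : M) {A : Set M}
    (hA : MeasurableSet A) (h : A ⊆ (chartAt (EuclideanSpace ℝ (Fin n)) x).source)
    (h' : A ⊆ (chartAt (EuclideanSpace ℝ (Fin n)) x').source) :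
    chartVolume g x A = chartVolume g x' A := by
  set φ := extChartAt (𝓡 n) x
  set φ' := extChartAt (𝓡 n) x'
  have hs : A ⊆ φ.source := by simpa [φ] using h
  have hs' : A ⊆ φ'.source := by simpa [φ'] using h'
  -- The two coordinate pictures of `A` correspond under the transition map, so the change of
  -- variables formula applies, and its Jacobian factor is absorbed by the densities.
  have himg : φ'.target ∩ φ'.symm ⁻¹' A = (φ' ∘ φ.symm) '' (φ.target ∩ φ.symm ⁻¹' A) := by
    ext y
    constructor
    · rintro ⟨hy, hyA⟩
      refine ⟨φ (φ'.symm y), ⟨φ.map_source (hs hyA), ?_⟩, ?_⟩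
      · rwa [Set.mem_preimage, φ.left_inv (hs hyA)]
      · rw [Function.comp_apply, φ.left_inv (hs hyA), φ'.right_inv hy]
    · rintro ⟨z, ⟨hz, hzA⟩, rfl⟩
      refine ⟨φ'.map_source (hs' hzA), ?_⟩
      rwa [Set.mem_preimage, Function.comp_apply, φ'.left_inv (hs' hzA)]
  have hinj : Set.InjOn (φ' ∘ φ.symm) (φ.target ∩ φ.symm ⁻¹' A) :=
    φ'.injOn.comp (φ.symm.injOn.mono Set.inter_subset_left) fun z hz ↦ hs' hz.2
  have hmeas := measurableSet_target_inter_preimage (n := n) x hA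
  rw [chartVolume_apply g x hA, chartVolume_apply g x' hA, himg,
    lintegral_image_eq_lintegral_abs_det_fderiv_mul volume hmeas
      (fun z hz ↦ (exists_hasFDerivAt_transition g hz.1 (h' hz.2)).1.hasFDerivWithinAt) hinj]
  refine setLIntegral_congr_fun hmeas fun z hz ↦ ?_
  rw [← ENNReal.ofReal_mul (abs_nonneg _), Function.comp_apply, φ'.left_inv (hs' hz.2)]
  exact congrArg ENNReal.ofReal (exists_hasFDerivAt_transition g hz.1 (h' hz.2)).2.symm

theorem riemannianVolume_restrict [T2Space M] (g : RiemMetric n M) (x : M) :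
    (riemannianVolume g).restrict (chartAt (EuclideanSpace ℝ (Fin n)) x).source =
      chartVolume g x := by
  set s := (chartAt (EuclideanSpace ℝ (Fin n)) x).source
  have hs : MeasurableSet s := (chartAt (EuclideanSpace ℝ (Fin n)) x).open_source.measurableSet
  -- To bound the supremum on the chart domain, a single measure above all chart measures suffices.
  -- It is infinite on nonempty measurable sets outside the domain, and inside it the other chart
  -- measures agree with this one on overlaps. Restriction to the domain removes the infinite part.
  have hle : riemannianVolume g ≤ chartVolume g x + ((⊤ : ENNReal) • Measure.count).restrict sᶜ := by
    refine iSup_le fun x' ↦ Measure.le_iff.2 fun A hA ↦ ?_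
    have hs' : MeasurableSet (chartAt (EuclideanSpace ℝ (Fin n)) x').source :=
      (chartAt (EuclideanSpace ℝ (Fin n)) x').open_source.measurableSet
    rw [← measure_inter_add_sdiff A hs, Measure.add_apply]
    refine add_le_add ?_ ?_
    · rw [← chartVolume_inter_source g x', ← chartVolume_eq_chartVolume g x x'
        ((hA.inter hs).inter hs') (fun _ h ↦ h.1.2) (fun _ h ↦ h.2)]
      exact measure_mono fun _ h ↦ h.1.1
    · rcases (A \ s).eq_empty_or_nonempty with h0 | h0
      · simp [h0]
      · rw [Measure.restrict_apply hA, ← Set.sdiff_eq, Measure.smul_apply, smul_eq_mul,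
          ENNReal.top_mul (by simpa [Measure.count_eq_zero_iff] using h0.ne_empty)]
        exact le_top
  ext A hA
  rw [Measure.restrict_apply hA]
  have hc : chartVolume g x (A ∩ s) = chartVolume g x A := chartVolume_inter_source g x A
  refine le_antisymm ((hle _).trans ?_) ?_
  · rw [Measure.add_apply, hc, Measure.restrict_apply (hA.inter hs), Set.inter_assoc,
      Set.inter_compl_self]
    simp
  · rw [← hc]
    exact le_iSup (fun x ↦ chartVolume g x) x _

end

/-! ### Integration against the Riemannian measure. -/

section

variable {n : ℕ} {M : Type*} [TopologicalSpace M] [ChartedSpace (EuclideanSpace ℝ (Fin n)) M]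
  [IsManifold (𝓡 n) ∞ M] [MeasurableSpace M] [BorelSpace M]

theorem lintegral_chartVolume (g : RiemMetric n M) (x : M) {h : M → ENNReal} (hh : Measurable h) :
    ∫⁻ z, h z ∂(chartVolume g x) = ∫⁻ y in (extChartAt (𝓡 n) x).target,
      ENNReal.ofReal (coordDensity g x ((extChartAt (𝓡 n) x).symm y)) *
        h ((extChartAt (𝓡 n) x).symm y) := by
  have hd := (aemeasurable_coordDensity_symm g x).ennreal_ofReal
  have hφ := aemeasurable_extChartAt_symm (n := n) x
  rw [chartVolume_eq, lintegral_map' hh.aemeasurable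
    (hφ.mono_ac (withDensity_absolutelyContinuous _ _))]
  exact lintegral_withDensity_eq_lintegral_mul₀ hd (hh.comp_aemeasurable hφ)

theorem integral_chartVolume (g : RiemMetric n M) (x : M) {f : M → ℝ} (hf : Measurable f) :
    ∫ z, f z ∂(chartVolume g x) = ∫ y in (extChartAt (𝓡 n) x).target,
      coordDensity g x ((extChartAt (𝓡 n) x).symm y) * f ((extChartAt (𝓡 n) x).symm y) := by
  have hd := (aemeasurable_coordDensity_symm g x).ennreal_ofReal
  have hφ := aemeasurable_extChartAt_symm (n := n) x
  rw [chartVolume_eq, integral_map (hφ.mono_ac (withDensity_absolutelyContinuous _ _))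
    hf.aestronglyMeasurable, integral_withDensity_eq_integral_toReal_smul₀ hd
    (Filter.Eventually.of_forall fun _ ↦ ENNReal.ofReal_lt_top)]
  refine integral_congr_ae (Filter.Eventually.of_forall fun y ↦ ?_)
  simp only [smul_eq_mul]
  rw [ENNReal.toReal_ofReal (coordDensity_nonneg g x _)]

/-- A small coordinate ball has its closure inside the chart's target, where the continuous density
is integrable over the compact closed ball. -/
theorem isLocallyFiniteMeasure_riemannianVolume [T2Space M] (g : RiemMetric n M) :
    IsLocallyFiniteMeasure (riemannianVolume g) := by
  refine ⟨fun x ↦ ?_⟩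
  set φ := extChartAt (𝓡 n) x
  obtain ⟨r, hr, hrs⟩ := Metric.nhds_basis_closedBall.mem_iff.1
    ((isOpen_extChartAt_target (I := 𝓡 n) x).mem_nhds (mem_extChartAt_target x))
  set A : Set M := φ.source ∩ φ ⁻¹' Metric.ball (φ x) r
  have hAo : IsOpen A := isOpen_extChartAt_preimage' (I := 𝓡 n) x Metric.isOpen_ball
  have hA : A ∈ nhds x :=
    hAo.mem_nhds ⟨mem_extChartAt_source x, Metric.mem_ball_self hr⟩
  refine ⟨A, hA, ?_⟩
  have h1 : riemannianVolume g A = chartVolume g x A := by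
    rw [← riemannianVolume_restrict g x, Measure.restrict_apply hAo.measurableSet,
      Set.inter_eq_left.2]
    intro z hz
    simpa [φ] using hz.1
  rw [h1, chartVolume_apply g x hAo.measurableSet]
  have h2 : IntegrableOn (fun y ↦ coordDensity g x (φ.symm y)) (Metric.closedBall (φ x) r) :=
    ((continuousOn_coordDensity_symm g x).mono hrs).integrableOn_compact
      (isCompact_closedBall _ _)
  refine lt_of_le_of_lt (lintegral_mono_set ?_) h2.lintegral_lt_top
  rintro y ⟨hy, hyA⟩
  have h3 : φ (φ.symm y) ∈ Metric.ball (φ x) r := hyA.2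
  rw [φ.right_inv hy] at h3
  exact Metric.ball_subset_closedBall h3

theorem integrable_riemannianVolume [T2Space M] [CompactSpace M] (g : RiemMetric n M)
    {f : M → ℝ} (hf : Continuous f) : Integrable f (riemannianVolume g) := by
  have := isLocallyFiniteMeasure_riemannianVolume g
  exact hf.integrable_of_hasCompactSupport (HasCompactSupport.of_compactSpace f)

/-- Second countability gives a countable cover by chart domains, so the measures may be compared on
each; there the density scales by `e^{nΥ}`. -/
theorem riemannianVolume_rescale [T2Space M] [SecondCountableTopology M] (g : RiemMetric n M)
    {Υ : M → ℝ} (hΥ : ContMDiff (𝓡 n) 𝓘(ℝ, ℝ) ∞ Υ) :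
    riemannianVolume (rescale g Υ hΥ) =
      (riemannianVolume g).withDensity fun x ↦ ENNReal.ofReal (Real.exp (n * Υ x)) := by
  have hm : Measurable fun x ↦ ENNReal.ofReal (Real.exp (n * Υ x)) :=
    (ENNReal.continuous_ofReal.comp
      (Real.continuous_exp.comp (continuous_const.mul hΥ.continuous))).measurable
  obtain ⟨s, hs, hsu⟩ := TopologicalSpace.countable_cover_nhds
    fun x : M ↦ chart_source_mem_nhds (EuclideanSpace ℝ (Fin n)) x
  refine (Measure.ext_iff_of_biUnion_eq_univ hs hsu).2 fun x _ ↦ ?_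
  have hsm : MeasurableSet (chartAt (EuclideanSpace ℝ (Fin n)) x).source :=
    (chartAt (EuclideanSpace ℝ (Fin n)) x).open_source.measurableSet
  rw [restrict_withDensity hsm, riemannianVolume_restrict, riemannianVolume_restrict]
  ext A hA
  rw [withDensity_apply _ hA, ← lintegral_indicator hA, ← lintegral_indicator_one hA,
    lintegral_chartVolume _ _ (measurable_one.indicator hA),
    lintegral_chartVolume _ _ (hm.indicator hA)]
  refine lintegral_congr fun y ↦ ?_
  by_cases hy : (extChartAt (𝓡 n) x).symm y ∈ A
  · simp only [Set.indicator_of_mem hy, Pi.one_apply, mul_one]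
    rw [coordDensity_rescale, ENNReal.ofReal_mul (coordDensity_nonneg g x _)]
  · simp only [Set.indicator_of_notMem hy, mul_zero]

theorem integral_riemannianVolume_rescale [T2Space M] [SecondCountableTopology M]
    (g : RiemMetric n M) {Υ : M → ℝ} (hΥ : ContMDiff (𝓡 n) 𝓘(ℝ, ℝ) ∞ Υ) (f : M → ℝ) :
    ∫ x, f x ∂(riemannianVolume (rescale g Υ hΥ)) =
      ∫ x, Real.exp (n * Υ x) * f x ∂(riemannianVolume g) := by
  have hm : Measurable fun x ↦ ENNReal.ofReal (Real.exp (n * Υ x)) :=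
    (ENNReal.continuous_ofReal.comp
      (Real.continuous_exp.comp (continuous_const.mul hΥ.continuous))).measurable
  rw [riemannianVolume_rescale, integral_withDensity_eq_integral_toReal_smul hm
    (Filter.Eventually.of_forall fun _ ↦ ENNReal.ofReal_lt_top)]
  simp only [smul_eq_mul, ENNReal.toReal_ofReal (Real.exp_pos _).le]

end

section

/-! ### The divergence theorem -/

/-- Integration by parts against the constant function `1`. -/
theorem integral_fderiv_eq_zero {E : Type*} [NormedAddCommGroup E] [NormedSpace ℝ E]
    [FiniteDimensional ℝ E] [MeasurableSpace E] [BorelSpace E] (μ : Measure E) [μ.IsAddHaarMeasure]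
    {F : E → ℝ} (hF : ContDiff ℝ 1 F) (hc : HasCompactSupport F) (v : E) :
    ∫ y, fderiv ℝ F y v ∂μ = 0 := by
  have h1 : Integrable (fun y ↦ fderiv ℝ F y v) μ :=
    ((hF.continuous_fderiv one_ne_zero).clm_apply continuous_const).integrable_of_hasCompactSupport
      (hc.fderiv_apply ℝ v)
  have h2 : Integrable F μ := hF.continuous.integrable_of_hasCompactSupport hc
  have h := integral_mul_fderiv_eq_neg_fderiv_mul_of_integrable (μ := μ) (f := fun _ ↦ (1 : ℝ))
    (g := F) (v := v) (by simp) (by simpa using h1) (by simpa using h2)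
    (fun _ _ ↦ differentiableAt_const _) (fun y _ ↦ hF.differentiable one_ne_zero y)
  simpa using h

variable {n : ℕ} {M : Type*} [TopologicalSpace M] [ChartedSpace (EuclideanSpace ℝ (Fin n)) M]
  [IsManifold (𝓡 n) ∞ M]

theorem fieldDiv_eq_zero_of_notMem_tsupport (g : RiemMetric n M) {ρ : M → ℝ}
    (X : Π y : M, TangentSpace (𝓡 n) y) {x : M} (hx : x ∉ tsupport ρ) :
    fieldDiv g (ρ • X) x = 0 := by
  have h0 : SmoothFieldAt (0 : Π y : M, TangentSpace (𝓡 n) y) x :=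
    (contMDiff_zeroSection ℝ (TangentSpace (𝓡 n) : M → Type _)) x
  have h1 : fieldDiv g (0 : Π y : M, TangentSpace (𝓡 n) y) x = 0 := by
    simpa using (fieldDiv_sum g (∅ : Finset Unit) (fun _ ↦ h0)).2
  rw [← h1]
  refine fieldDiv_congr g h0.fieldDiffAt ?_
  filter_upwards [(isClosed_tsupport ρ).isOpen_compl.mem_nhds hx] with y hy
  rw [Pi.smul_apply', image_eq_zero_of_notMem_tsupport hy, zero_smul]
  rfl

variable [MeasurableSpace M] [BorelSpace M]

/-- The integral becomes one over the chart's target, where the integrand is a sum of partial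
derivatives of compactly supported functions. -/
theorem integral_fieldDiv_smul_eq_zero [T2Space M] [CompactSpace M] (g : RiemMetric n M) {x₀ : M}
    {ρ : M → ℝ} (hρ : ∀ x, SmoothFnAt n ρ x)
    (hs : tsupport ρ ⊆ (chartAt (EuclideanSpace ℝ (Fin n)) x₀).source)
    {X : Π y : M, TangentSpace (𝓡 n) y} (hX : ∀ x, SmoothFieldAt X x) :
    ∫ x, fieldDiv g (ρ • X) x ∂(riemannianVolume g) = 0 := by
  set φ := extChartAt (𝓡 n) x₀ with hφ
  have hZ : ∀ x, SmoothFieldAt (ρ • X) x := fun x ↦ (hX x).smul (hρ x)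
  have hcont : Continuous (fieldDiv g (ρ • X)) :=
    continuous_iff_continuousAt.2 fun x ↦ (smoothFnAt_fieldDiv g (hZ x)).continuousAt
  have hsrc : tsupport ρ ⊆ φ.source := by simpa [hφ] using hs
  rw [← setIntegral_eq_integral_of_forall_compl_eq_zero
    (s := (chartAt (EuclideanSpace ℝ (Fin n)) x₀).source)
    fun x hx ↦ fieldDiv_eq_zero_of_notMem_tsupport g X fun h ↦ hx (hs h),
    riemannianVolume_restrict, integral_chartVolume g x₀ hcont.measurable]
  set K := φ '' tsupport ρ with hKdef
  have hK : IsCompact K := (isClosed_tsupport ρ).isCompact.image_of_continuousOn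
    ((continuousOn_extChartAt x₀).mono hsrc)
  have hKt : K ⊆ φ.target := by
    rintro _ ⟨z, hz, rfl⟩
    exact φ.map_source (hsrc hz)
  let c : Fin n → M → ℝ := fun i ↦ coordDensity g x₀ * coordCoeff x₀ (ρ • X) i
  -- Extension by zero is harmless: `F i` is smooth on the target and vanishes off the compact set
  -- `K` inside it, and the target and the complement of `K` are open sets covering the space.
  let F : Fin n → EuclideanSpace ℝ (Fin n) → ℝ := fun i ↦ φ.target.indicator (c i ∘ φ.symm)
  have hF0 : ∀ i, ∀ y ∉ K, F i y = 0 := by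
    intro i y hy
    by_cases hyt : y ∈ φ.target
    · have hz : φ.symm y ∉ tsupport ρ := fun h ↦ hy ⟨_, h, φ.right_inv hyt⟩
      simp only [F, c, Set.indicator_of_mem hyt, Function.comp_apply, Pi.mul_apply]
      rw [coordCoeff_eq _ _ _ (mem_chart_source_of_mem_target hyt), Pi.smul_apply',
        image_eq_zero_of_notMem_tsupport hz, zero_smul, map_zero, Finsupp.zero_apply, mul_zero]
    · exact Set.indicator_of_notMem hyt _
  have hFe : ∀ i, ∀ y ∈ φ.target, F i =ᶠ[nhds y] c i ∘ φ.symm := fun i y hy ↦ by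
    filter_upwards [(isOpen_extChartAt_target (I := 𝓡 n) x₀).mem_nhds hy] with z hz
    exact Set.indicator_of_mem hz _
  have hc : ∀ i, ∀ z ∈ (chartAt (EuclideanSpace ℝ (Fin n)) x₀).source, SmoothFnAt n (c i) z :=
    fun i z hz ↦ ContMDiffAt.mul (smoothFnAt_coordDensity g hz)
      ((smoothFieldAt_iff_coordCoeff x₀ _ hz).1 (hZ z) i)
  have hF : ∀ i, ContDiff ℝ 1 (F i) := fun i ↦ contDiff_iff_contDiffAt.2 fun y ↦ by
    by_cases hyt : y ∈ φ.target
    · have hz := mem_chart_source_of_mem_target hyt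
      have h := contDiffAt_comp_extChartAt_symm hz (hc i _ hz)
      rw [φ.right_inv hyt] at h
      exact (h.of_le (by simp)).congr_of_eventuallyEq (hFe i y hyt)
    · refine (contDiffAt_const (c := (0 : ℝ))).congr_of_eventuallyEq ?_
      filter_upwards [hK.isClosed.isOpen_compl.mem_nhds fun h ↦ hyt (hKt h)] with z hz
      exact hF0 i z hz
  have hFc : ∀ i, HasCompactSupport (F i) := fun i ↦ HasCompactSupport.intro hK (hF0 i)
  have hF1 : ∀ i, Integrable fun y ↦ fderiv ℝ (F i) y (EuclideanSpace.single i (1 : ℝ)) := fun i ↦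
    (((hF i).continuous_fderiv one_ne_zero).clm_apply
      continuous_const).integrable_of_hasCompactSupport ((hFc i).fderiv_apply ℝ _)
  calc ∫ y in φ.target, coordDensity g x₀ (φ.symm y) * fieldDiv g (ρ • X) (φ.symm y)
      = ∫ y in φ.target, ∑ i, fderiv ℝ (F i) y (EuclideanSpace.single i (1 : ℝ)) := by
        refine setIntegral_congr_fun (isOpen_extChartAt_target x₀).measurableSet fun y hy ↦ ?_
        have hz := mem_chart_source_of_mem_target hy
        rw [coordDensity_mul_fieldDiv g hz (hZ _)]
        refine Finset.sum_congr rfl fun i _ ↦ ?_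
        rw [mvfderiv_coordFrame hz (hc i _ hz).mdifferentiableAt, (hFe i y hy).fderiv_eq,
          φ.right_inv hy]
    _ = ∑ i, ∫ y in φ.target, fderiv ℝ (F i) y (EuclideanSpace.single i (1 : ℝ)) :=
        integral_finsetSum _ fun i _ ↦ (hF1 i).integrableOn
    _ = 0 := by
        refine Finset.sum_eq_zero fun i _ ↦ ?_
        rw [setIntegral_eq_integral_of_forall_compl_eq_zero, integral_fderiv_eq_zero _ (hF i) (hFc i)]
        intro y hy
        have h0 : F i =ᶠ[nhds y] fun _ ↦ 0 := by
          filter_upwards [hK.isClosed.isOpen_compl.mem_nhds fun h ↦ hy (hKt h)] with z hz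
          exact hF0 i z hz
        rw [h0.fderiv_eq]
        simp

/-- The divergence theorem on a closed manifold. -/
theorem integral_fieldDiv_eq_zero [T2Space M] [CompactSpace M] (g : RiemMetric n M)
    {X : Π y : M, TangentSpace (𝓡 n) y} (hX : ∀ x, SmoothFieldAt X x) :
    ∫ x, fieldDiv g X x ∂(riemannianVolume g) = 0 := by
  obtain ⟨s, hs⟩ := CompactSpace.elim_nhds_subcover
    (fun x : M ↦ (chartAt (EuclideanSpace ℝ (Fin n)) x).source)
    fun x ↦ chart_source_mem_nhds (EuclideanSpace ℝ (Fin n)) x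
  -- The partition is indexed by a finite cover, so the field is a finite sum of pieces, each
  -- supported in one chart domain.
  obtain ⟨f, hf⟩ := SmoothPartitionOfUnity.exists_isSubordinate (𝓡 n) (isClosed_univ (X := M))
    (fun x : s ↦ (chartAt (EuclideanSpace ℝ (Fin n)) (x : M)).source)
    (fun x ↦ (chartAt (EuclideanSpace ℝ (Fin n)) (x : M)).open_source)
    (by
      intro y hy
      have : y ∈ ⋃ x ∈ s, (chartAt (EuclideanSpace ℝ (Fin n)) x).source := hs ▸ hy
      simpa using this)
  have hfs : ∀ i x, SmoothFnAt n (f i) x := fun i x ↦ (f i).contMDiff x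
  have hfX : ∀ i x, SmoothFieldAt ((f i : M → ℝ) • X) x := fun i x ↦ (hX x).smul (hfs i x)
  have hsum : X = ∑ i, (f i : M → ℝ) • X := by
    ext1 x
    have h1 := f.sum_eq_one (Set.mem_univ x)
    rw [finsum_eq_sum_of_fintype] at h1
    rw [Finset.sum_apply]
    simp only [Pi.smul_apply']
    rw [← Finset.sum_smul, h1, one_smul]
  have hdiv : fieldDiv g X = fun x ↦ ∑ i, fieldDiv g ((f i : M → ℝ) • X) x := by
    ext1 x
    conv_lhs => rw [hsum]
    exact (fieldDiv_sum g Finset.univ fun i ↦ hfX i x).2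
  rw [hdiv, integral_finsetSum]
  · exact Finset.sum_eq_zero fun i _ ↦ integral_fieldDiv_smul_eq_zero g (hfs i) (hf i) hX
  · exact fun i _ ↦ integrable_riemannianVolume g (continuous_iff_continuousAt.2 fun x ↦
      (smoothFnAt_fieldDiv g (hfX i x)).continuousAt)

theorem integral_divergence_eq_zero [T2Space M] [CompactSpace M] (g : RiemMetric n M) {u : Form n M}
    (hu : ∀ x, SmoothFieldAt (fun y ↦ sharp g y (u y)) x) :
    ∫ x, divergence g u x ∂(riemannianVolume g) = 0 := by
  rw [← integral_fieldDiv_eq_zero g hu]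
  exact integral_congr_ae (Filter.Eventually.of_forall fun x ↦
    divergence_eq_fieldDiv g (hu x).fieldDiffAt)

end

end ConfQ
end

theorem corollary3p2 {M : Type*} [TopologicalSpace M] [T2Space M] [SecondCountableTopology M]
    [ChartedSpace (EuclideanSpace ℝ (Fin 4)) M] [IsManifold (𝓡 4) ∞ M]
    [MeasurableSpace M] [BorelSpace M]
    (g : ConfQ.RiemMetric 4 M) (u v : ConfQ.Form 4 M)
    (hu : ConfQ.IsSmoothForm u) (hv : ConfQ.IsSmoothForm v)
    (hu' : ConfQ.IsClosedForm u) (hv' : ConfQ.IsClosedForm v)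
    (Υ : M → ℝ) (hΥ : ContMDiff (𝓡 4) 𝓘(ℝ, ℝ) ∞ Υ) :
    (∀ x, ConfQ.Q1Density (ConfQ.rescale g Υ hΥ) u v x = ConfQ.Q1Density g u v x
        + (4 : ℝ) • ConfQ.inScale g (-4) (ConfQ.divergence g (ConfQ.skewContraction g u v Υ)) x) ∧
    (CompactSpace M →
      Integrable (ConfQ.Q1Pair g u v) (ConfQ.riemannianVolume g) ∧
      Integrable (ConfQ.Q1Pair (ConfQ.rescale g Υ hΥ) u v)
        (ConfQ.riemannianVolume (ConfQ.rescale g Υ hΥ)) ∧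
      ∫ x, ConfQ.Q1Pair (ConfQ.rescale g Υ hΥ) u v x
          ∂(ConfQ.riemannianVolume (ConfQ.rescale g Υ hΥ)) =
        ∫ x, ConfQ.Q1Pair g u v x ∂(ConfQ.riemannianVolume g)) := by
  refine ⟨ConfQ.Q1Density_rescale g hu hv hu' hv' hΥ, fun _ ↦ ?_⟩
  have hQ := ConfQ.integrable_riemannianVolume g (ConfQ.continuous_Q1Pair g hu hv)
  refine ⟨hQ, ConfQ.integrable_riemannianVolume _ (ConfQ.continuous_Q1Pair _ hu hv), ?_⟩
  have hs := ConfQ.smoothFieldAt_sharp_skewContraction g hu hv hΥ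
  have hd : Integrable (ConfQ.divergence g (ConfQ.skewContraction g u v Υ))
      (ConfQ.riemannianVolume g) := by
    have h : ConfQ.divergence g (ConfQ.skewContraction g u v Υ) = ConfQ.fieldDiv g _ :=
      funext fun x ↦ ConfQ.divergence_eq_fieldDiv g (hs x).fieldDiffAt
    rw [h]
    exact ConfQ.integrable_riemannianVolume g (continuous_iff_continuousAt.2 fun x ↦
      (ConfQ.smoothFnAt_fieldDiv g (hs x)).continuousAt)
  calc ∫ x, ConfQ.Q1Pair (ConfQ.rescale g Υ hΥ) u v x
          ∂(ConfQ.riemannianVolume (ConfQ.rescale g Υ hΥ))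
      = ∫ x, Real.exp (4 * Υ x) * ConfQ.Q1Pair (ConfQ.rescale g Υ hΥ) u v x
          ∂(ConfQ.riemannianVolume g) := by
        -- In dimension four the volume factor `e^{nΥ}` is exactly the factor in `Q1Pair_rescale`.
        rw [ConfQ.integral_riemannianVolume_rescale g hΥ]
        norm_num
    _ = ∫ x, ConfQ.Q1Pair g u v x + 4 * ConfQ.divergence g (ConfQ.skewContraction g u v Υ) x
          ∂(ConfQ.riemannianVolume g) :=
        integral_congr_ae (Filter.Eventually.of_forall
          (ConfQ.Q1Pair_rescale g hu hv hu' hv' hΥ))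
    _ = ∫ x, ConfQ.Q1Pair g u v x ∂(ConfQ.riemannianVolume g) := by
        rw [integral_add hQ (hd.const_mul 4), integral_const_mul,
          ConfQ.integral_divergence_eq_zero g hs, mul_zero, add_zero]
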